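/- Let $p$ be a prime, $n\ge 1$, let $A$ be a cyclic group of order $p^n$, and let $k$ be an algebraically closed field of characteristic $q\neq p$ (possibly $q=0$) with a fixed embedding $A\hookrightarrow k^\times$. For a finite group $G$, an $A$-fibered $G$-set is an $A\times G$-set on which $A$ acts freely with finitely many orbits (called fibers). Let $B^A(G)$ be the Grothendieck group of $A$-fibered $G$-sets with respect to disjoint unions, and $kB^A(G)=k\otimes_{\mathbb Z} B^A(G)$. For a normal subgroup $N$ of $G$, the deflation map $\mathrm{Def}^G_{G/N}\colon kB^A(G)\to kB^A(G/N)$ is the $k$-linear map sending the class of $X$ to the class of $(A\times G/N)\otimes_{AG}X$. Here $A\times G/N$ is the $A$-fibered $(G/N,G)$-biset on which $G/N$ and $G$ act through left and right multiplication on $G/N$, and $\otimes_{AG}$ denotes the set of those elements of the amalgamated product over $A\times G$ on which $A$ acts freely. For a subgroup $K\le G$ and $l\in K$, the species $s^G_{K,l}\colon kB^A(G)\to k$ is the $k$-linear map given by $s^G_{K,l}[X]=\sum_{Ax}\phi_x(l)$, where $Ax$ runs over the fibers of $X$ stabilized by $K$, and $\phi_x\colon K\to A\subseteq k^\times$ is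 defined by $u\cdot x=\phi_x(u)\cdot x$. Let $O(K)$ be the intersection of the kernels of all homomorphisms $K\to A$. For $g\in G$, the idempotent $e^G_{G,g}\in kB^A(G)$ is the unique element such that, for all $K\le G$ and $l\in K$, $s^G_{K,l}(e^G_{G,g})=1$ if $K=G$ and $lO(G)$ is $G$-conjugate to $gO(G)$, and $s^G_{K,l}(e^G_{G,g})=0$ otherwise. Let $G$ be an elementary abelian $p$-group of rank $r$, let $1\neq h\in G$, let $H=\langle h\rangle$, and let $g\in G$. Then the idempotents $e^G_{G,g}\in kB^A(G)$ and $e^{G/H}_{G/H,gH}\in kB^A(G/H)$ exist and are unique, and $$\mathrm{Def}^{G}_{G/H}\,e^{G}_{G,g}= m_{g,H}\cdot e^{G/H}_{G/H,gH},\qquad m_{g,H}=\begin{cases}\dfrac{1-p^{r-1}}{p} & \text{if } g=1,\\[2mm] \dfrac1p & \text{if } g\ne 1,\ g\in H,\\[2mm] \dfrac{1-p^{r-2}}{p} & \text{if } g\notin H,\end{cases}$$ where the constants $m_{g,H}$ are read in $k$. -/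

import Mathlib

universe u v

namespace FiberedBurnside

open scoped Classical

noncomputable section

/-- An `A`-fibered `G`-set: a set with commuting actions of `A` and `G` (that is, an `A × G`-set)
on which `A` acts freely with finitely many orbits. -/
structure FiberedSet (A G : Type u) [CommGroup A] [Group G] where
  carrier : Type u
  [actA : MulAction A carrier]
  [actG : MulAction G carrier]
  [comm : SMulCommClass A G carrier]
  free : ∀ (a : A) (x : carrier), a • x = x → a = 1
  finite : Finite (MulAction.orbitRel.Quotient A carrier)

attribute [instance] FiberedSet.actA FiberedSet.actG FiberedSet.comm FiberedSet.finite

section basics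

variable {A G L : Type u} [CommGroup A] [Group G] [Group L]

/-- The set of fibers (`A`-orbits) of an `A`-fibered `G`-set. -/
abbrev Fibers (X : FiberedSet A G) : Type u := MulAction.orbitRel.Quotient A X.carrier

/-- `f` is an isomorphism of `A`-fibered `G`-sets. -/
def IsIso {X Y : FiberedSet A G} (f : X.carrier ≃ Y.carrier) : Prop :=
  (∀ (a : A) (x : X.carrier), f (a • x) = a • f x) ∧
    ∀ (g : G) (x : X.carrier), f (g • x) = g • f x

/-- The two `A`-fibered `G`-sets are isomorphic. -/
def Isom (X Y : FiberedSet A G) : Prop :=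
  ∃ f : X.carrier ≃ Y.carrier, IsIso f

theorem isom_symm {X Y : FiberedSet A G} (h : Isom X Y) : Isom Y X := by
  obtain ⟨f, hA, hG⟩ := h
  refine ⟨f.symm, fun a y => ?_, fun g y => ?_⟩
  · rw [Equiv.symm_apply_eq, hA, f.apply_symm_apply]
  · rw [Equiv.symm_apply_eq, hG, f.apply_symm_apply]

theorem mk_eq_mk_iff {X : FiberedSet A G} (x y : X.carrier) :
    (Quotient.mk'' x : Fibers X) = Quotient.mk'' y ↔ ∃ a : A, a • y = x := by
  rw [Quotient.eq'']
  rfl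

/-- The fibers of a disjoint union. -/
def sumFibers (X Y : FiberedSet A G) :
    MulAction.orbitRel.Quotient A (X.carrier ⊕ Y.carrier) ≃ Fibers X ⊕ Fibers Y where
  toFun := Quotient.lift
    (Sum.map (fun x => (Quotient.mk'' x : Fibers X)) (fun y => (Quotient.mk'' y : Fibers Y)))
    (by
      rintro s t ⟨a, h⟩
      rcases s with s | s <;> rcases t with t | t <;> cases h
      · exact congrArg Sum.inl ((mk_eq_mk_iff _ _).2 ⟨a, rfl⟩)
      · exact congrArg Sum.inr ((mk_eq_mk_iff _ _).2 ⟨a, rfl⟩))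
  invFun := Sum.elim
    (Quotient.lift (fun x => Quotient.mk'' (Sum.inl x)) (by
      rintro s t ⟨a, rfl⟩
      exact Quotient.sound ⟨a, rfl⟩))
    (Quotient.lift (fun x => Quotient.mk'' (Sum.inr x)) (by
      rintro s t ⟨a, rfl⟩
      exact Quotient.sound ⟨a, rfl⟩))
  left_inv := by
    rintro ⟨x | y⟩ <;> rfl
  right_inv := by
    rintro (q | q) <;> induction q using Quotient.inductionOn <;> rfl

/-- The disjoint union of two `A`-fibered `G`-sets. -/
def disjUnion (X Y : FiberedSet A G) : FiberedSet A G where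
  carrier := X.carrier ⊕ Y.carrier
  free := by
    rintro a (x | y) h
    · exact X.free a x (Sum.inl_injective h)
    · exact Y.free a y (Sum.inr_injective h)
  finite := Finite.of_equiv _ (sumFibers X Y).symm

variable (k : Type v) [Field k]

/-- The relations defining `k ⊗ B^A(G)`: isomorphic sets are identified, and disjoint union
becomes addition. -/
inductive Rel : (FiberedSet A G →₀ k) → Prop
  | iso (X Y : FiberedSet A G) (h : Isom X Y) :
      Rel (Finsupp.single X 1 - Finsupp.single Y 1)
  | add (X Y : FiberedSet A G) :
      Rel (Finsupp.single (disjUnion X Y) 1 - (Finsupp.single X 1 + Finsupp.single Y 1))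

variable (A G) in
/-- The `A`-fibered Burnside group `k B^A(G) = k ⊗ B^A(G)` with coefficients in `k`: the
`k`-linear Grothendieck group of `A`-fibered `G`-sets with respect to disjoint unions. -/
abbrev kB : Type (max (u + 1) v) :=
  (FiberedSet A G →₀ k) ⧸ Submodule.span k {x : FiberedSet A G →₀ k | Rel k x}

/-- The class `[X]` in `k B^A(G)`. -/
def cls (X : FiberedSet A G) : kB A G k :=
  Submodule.Quotient.mk (Finsupp.single X 1)

/-- A function on `A`-fibered `G`-sets that is invariant under isomorphism and additive on disjoint
unions extends linearly to `k B^A(G)`. -/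
def lift {M : Type*} [AddCommGroup M] [Module k M] (F : FiberedSet A G → M)
    (hiso : ∀ X Y, Isom X Y → F X = F Y)
    (hadd : ∀ X Y, F (disjUnion X Y) = F X + F Y) : kB A G k →ₗ[k] M :=
  Submodule.liftQ _ (Finsupp.linearCombination k F) (by
    rw [Submodule.span_le]
    rintro x (⟨X, Y, h⟩ | ⟨X, Y⟩)
    · simp [hiso X Y h]
    · simp [hadd X Y])

theorem lift_cls {M : Type*} [AddCommGroup M] [Module k M] (F : FiberedSet A G → M)
    (hiso : ∀ X Y, Isom X Y → F X = F Y)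
    (hadd : ∀ X Y, F (disjUnion X Y) = F X + F Y) (X : FiberedSet A G) :
    lift k F hiso hadd (cls k X) = F X := by
  simp [lift, cls]

theorem cls_iso {X Y : FiberedSet A G} (h : Isom X Y) : cls k X = cls k Y :=
  (Submodule.Quotient.eq _).2 (Submodule.subset_span (Rel.iso X Y h))

theorem cls_disjUnion (X Y : FiberedSet A G) :
    cls k (disjUnion X Y) = cls k X + cls k Y :=
  (Submodule.Quotient.eq _).2 (Submodule.subset_span (Rel.add X Y))

/-! ### Species -/

/-- The fiber `A x` is stabilized by the subgroup `H`. -/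
def IsStable {X : FiberedSet A G} (H : Subgroup G) (x : X.carrier) : Prop :=
  ∀ g ∈ H, ∃ a : A, g • x = a • x

/-- `φ_x(h)`: the (unique) `a` in `A` with `h • x = a • x`, if there is one. -/
def fiberChar {X : FiberedSet A G} (h : G) (x : X.carrier) : A :=
  Classical.epsilon fun a : A => h • x = a • x

theorem smul_eq_iff {X : FiberedSet A G} (g : G) (a b : A) (x : X.carrier) :
    g • b • x = a • b • x ↔ g • x = a • x := by
  rw [← smul_comm b g x, smul_comm a b x, smul_left_cancel_iff]

theorem isStable_smul {X : FiberedSet A G} (H : Subgroup G) (b : A) (x : X.carrier) :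
    IsStable H (b • x) ↔ IsStable H x := by
  simp only [IsStable, smul_eq_iff]

theorem fiberChar_smul {X : FiberedSet A G} (h : G) (b : A) (x : X.carrier) :
    fiberChar (A := A) h (b • x) = fiberChar h x := by
  simp only [fiberChar, smul_eq_iff]

variable {k}

/-- The contribution of a fiber `A x` to the species at `(H, h)`: it is `φ_x(h)`, viewed in `k`
through `ι`, if the fiber is stabilized by `H`, and zero otherwise. -/
def fiberTerm (ι : A →* kˣ) (H : Subgroup G) (h : G) (X : FiberedSet A G) : Fibers X → k :=
  Quotient.lift (fun x : X.carrier => if IsStable H x then (ι (fiberChar h x) : k) else 0) (by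
    rintro s t ⟨a, rfl⟩
    simp only [isStable_smul, fiberChar_smul])

theorem fiberTerm_congr (ι : A →* kˣ) (H : Subgroup G) (h : G) {X Y : FiberedSet A G}
    (x : X.carrier) (y : Y.carrier)
    (hxy : ∀ (g : G) (a : A), g • x = a • x ↔ g • y = a • y) :
    fiberTerm ι H h X (Quotient.mk'' x) = fiberTerm ι H h Y (Quotient.mk'' y) := by
  have h1 : IsStable H x ↔ IsStable H y :=
    forall_congr' fun g => forall_congr' fun _ => exists_congr fun a => hxy g a
  have h2 : fiberChar (A := A) h x = fiberChar h y :=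
    congrArg Classical.epsilon (funext fun a => propext (hxy h a))
  change (if IsStable H x then (ι (fiberChar h x) : k) else 0) =
    (if IsStable H y then (ι (fiberChar h y) : k) else 0)
  rw [h2]
  exact if_congr h1 rfl rfl

/-- The value of the species at `(H, h)` on an `A`-fibered `G`-set `X`:
the sum of `φ_x(h)` over the fibers `A x` of `X` that are stabilized by `H`. -/
def speciesVal (ι : A →* kˣ) (H : Subgroup G) (h : G) (X : FiberedSet A G) : k :=
  ∑ᶠ q : Fibers X, fiberTerm ι H h X q

theorem speciesVal_iso (ι : A →* kˣ) (H : Subgroup G) (h : G) (X Y : FiberedSet A G)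
    (e : Isom X Y) : speciesVal ι H h X = speciesVal ι H h Y := by
  obtain ⟨f, hA, hG⟩ := e
  have key : ∀ (g : G) (a : A) (x : X.carrier), g • f x = a • f x ↔ g • x = a • x := by
    intro g a x
    rw [← hA, ← hG, f.apply_eq_iff_eq]
  refine finsum_eq_of_bijective
    (Quotient.map f (by rintro s t ⟨a, rfl⟩; exact ⟨a, (hA a t).symm⟩)) ⟨?_, ?_⟩ ?_
  · rintro ⟨x⟩ ⟨y⟩ hxy
    obtain ⟨a, ha⟩ := Quotient.exact hxy
    exact Quotient.sound ⟨a, f.injective ((hA a y).trans ha)⟩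
  · rintro ⟨y⟩
    exact ⟨Quotient.mk'' (f.symm y), congrArg Quotient.mk'' (f.apply_symm_apply y)⟩
  · rintro ⟨x⟩
    exact fiberTerm_congr ι H h x (f x) fun g a => (key g a x).symm

theorem speciesVal_disjUnion (ι : A →* kˣ) (H : Subgroup G) (h : G) (X Y : FiberedSet A G) :
    speciesVal ι H h (disjUnion X Y) = speciesVal ι H h X + speciesVal ι H h Y := by
  have := Fintype.ofFinite (Fibers X)
  have := Fintype.ofFinite (Fibers Y)
  have h1 : speciesVal ι H h (disjUnion X Y) =
      ∑ᶠ q : Fibers X ⊕ Fibers Y, Sum.elim (fiberTerm ι H h X) (fiberTerm ι H h Y) q := by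
    refine finsum_eq_of_bijective (sumFibers X Y) (sumFibers X Y).bijective ?_
    rintro ⟨x | x⟩
    · exact fiberTerm_congr (X := disjUnion X Y) ι H h (Sum.inl x) x
        fun g a => Sum.inl_injective.eq_iff
    · exact fiberTerm_congr (X := disjUnion X Y) ι H h (Sum.inr x) x
        fun g a => Sum.inr_injective.eq_iff
  rw [h1, finsum_eq_sum_of_fintype, Fintype.sum_sum_type, speciesVal, speciesVal,
    finsum_eq_sum_of_fintype, finsum_eq_sum_of_fintype]
  rfl

/-- The species `s^G_{H,h} : k B^A(G) → k`. -/
def species (ι : A →* kˣ) (H : Subgroup G) (h : G) : kB A G k →ₗ[k] k :=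
  lift k (speciesVal ι H h) (speciesVal_iso ι H h) (speciesVal_disjUnion ι H h)

variable (A) in
/-- `O(H)`, the intersection of the kernels of all homomorphisms `H → A`, as a subgroup of `G`. -/
def homKer (H : Subgroup G) : Subgroup G :=
  (⨅ φ : H →* A, φ.ker).map H.subtype

variable (A) in
/-- `(H, h)` and `(K, l)`, with `h ∈ H` and `l ∈ K` taken modulo `O(H)` and `O(K)`, are
conjugate in `G`. -/
def PairConj (H : Subgroup G) (h : G) (K : Subgroup G) (l : G) : Prop :=
  ∃ x : G, H.map (MulAut.conj x).toMonoidHom = K ∧ (x * h * x⁻¹) * l⁻¹ ∈ homKer A K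

/-- `e` is the idempotent `e^G_{H,h}` of `k B^A(G)`: its species at `(K, l)` is `1` if `(K, l)` is
conjugate to `(H, h)`, and `0` otherwise. -/
def IsIdempotentAt (ι : A →* kˣ) (H : Subgroup G) (h : G) (e : kB A G k) : Prop :=
  ∀ (K : Subgroup G) (l : G), l ∈ K →
    species ι K l e = if PairConj A H h K l then 1 else 0

/-! ### Fibered bisets and their action -/

/-- The equivalence relation on `X × Y` whose classes are the orbits of `A × G` acting by
`(a, h) • (x, y) = (x • (a⁻¹, h⁻¹), (a, h) • y)`. Here `X` is an `A`-fibered `(L, G)`-biset, that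
is, an `A`-fibered `L × G`-set, with right action `x • h = (1, h⁻¹) • x`. -/
def amalgSetoid (X : FiberedSet A (L × G)) (Y : FiberedSet A G) :
    Setoid (X.carrier × Y.carrier) where
  r s t := ∃ (a : A) (h : G),
    t.1 = a⁻¹ • ((1 : L), h) • s.1 ∧ t.2 = a • h • s.2
  iseqv :=
    { refl := fun s => ⟨1, 1, by
          rw [show ((1 : L), (1 : G)) = 1 from rfl]; simp, by simp⟩
      symm := by
        rintro s t ⟨a, h, h1, h2⟩
        refine ⟨a⁻¹, h⁻¹, ?_, ?_⟩
        · rw [h1, smul_comm a⁻¹ ((1 : L), h) s.1, smul_smul ((1 : L), h⁻¹)]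
          simp [show ((1 : L), (1 : G)) = 1 from rfl]
        · rw [h2, smul_comm a h s.2, smul_smul h⁻¹]
          simp
      trans := by
        rintro s t w ⟨a, h, h1, h2⟩ ⟨b, g, h3, h4⟩
        refine ⟨b * a, g * h, ?_, ?_⟩
        · rw [h3, h1, ← smul_comm a⁻¹ ((1 : L), g), smul_smul, smul_smul]
          simp [mul_comm]
        · rw [h4, h2, ← smul_comm a g, smul_smul, smul_smul] }

/-- The amalgamated product `X ×_{AG} Y`. -/
def Amalg (X : FiberedSet A (L × G)) (Y : FiberedSet A G) : Type u :=
  Quotient (amalgSetoid X Y)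

/-- The class of a pair in the amalgamated product. -/
def Amalg.mk {X : FiberedSet A (L × G)} {Y : FiberedSet A G} (x : X.carrier) (y : Y.carrier) :
    Amalg X Y :=
  Quotient.mk (amalgSetoid X Y) (x, y)

theorem Amalg.mk_eq {X : FiberedSet A (L × G)} {Y : FiberedSet A G} {x x' : X.carrier}
    {y y' : Y.carrier} : Amalg.mk x y = Amalg.mk x' y' ↔
      ∃ (a : A) (h : G), x' = a⁻¹ • ((1 : L), h) • x ∧ y' = a • h • y :=
  Quotient.eq (r := amalgSetoid X Y)

theorem Amalg.exists_rep {X : FiberedSet A (L × G)} {Y : FiberedSet A G} (q : Amalg X Y) :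
    ∃ x y, q = Amalg.mk x y := by
  obtain ⟨⟨x, y⟩, rfl⟩ := Quotient.exists_rep q
  exact ⟨x, y, rfl⟩

/-- `a • [x, y] = [a • x, y]`. -/
instance (X : FiberedSet A (L × G)) (Y : FiberedSet A G) : MulAction A (Amalg X Y) where
  smul a := Quotient.map (fun s => (a • s.1, s.2)) (by
    rintro s t ⟨b, h, h1, h2⟩
    refine ⟨b, h, ?_, h2⟩
    change a • t.1 = _
    rw [h1, smul_comm a b⁻¹, smul_comm a ((1 : L), h)])
  one_smul := by
    rintro ⟨x, y⟩
    exact congrArg (fun z => Amalg.mk z y) (one_smul A x)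
  mul_smul := by
    rintro a b ⟨x, y⟩
    exact congrArg (fun z => Amalg.mk z y) (mul_smul a b x)

/-- `l • [x, y] = [(l, 1) • x, y]`. -/
instance (X : FiberedSet A (L × G)) (Y : FiberedSet A G) : MulAction L (Amalg X Y) where
  smul l := Quotient.map (fun s => ((l, (1 : G)) • s.1, s.2)) (by
    rintro s t ⟨b, h, h1, h2⟩
    refine ⟨b, h, ?_, h2⟩
    change (l, (1 : G)) • t.1 = _
    rw [h1, ← smul_comm b⁻¹ (l, (1 : G)), smul_smul (l, (1 : G)), smul_smul ((1 : L), h)]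
    simp)
  one_smul := by
    rintro ⟨x, y⟩
    exact congrArg (fun z => Amalg.mk z y) (one_smul (L × G) x)
  mul_smul := by
    rintro a b ⟨x, y⟩
    refine congrArg (fun z => Amalg.mk z y) ?_
    change (a * b, (1 : G)) • x = (a, (1 : G)) • (b, (1 : G)) • x
    rw [smul_smul]
    simp

theorem Amalg.smulA_mk {X : FiberedSet A (L × G)} {Y : FiberedSet A G} (a : A) (x : X.carrier)
    (y : Y.carrier) : a • Amalg.mk x y = Amalg.mk (a • x) y := rfl

theorem Amalg.smulL_mk {X : FiberedSet A (L × G)} {Y : FiberedSet A G} (l : L) (x : X.carrier)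
    (y : Y.carrier) : l • Amalg.mk x y = Amalg.mk ((l, (1 : G)) • x) y := rfl

theorem Amalg.mk_smul {X : FiberedSet A (L × G)} {Y : FiberedSet A G} (a : A) (x : X.carrier)
    (y : Y.carrier) : Amalg.mk x (a • y) = a • Amalg.mk x y := by
  rw [Amalg.smulA_mk, Amalg.mk_eq]
  refine ⟨a⁻¹, 1, ?_, ?_⟩
  · rw [show ((1 : L), (1 : G)) = 1 from rfl]; simp
  · simp

instance (X : FiberedSet A (L × G)) (Y : FiberedSet A G) :
    SMulCommClass A L (Amalg X Y) where
  smul_comm := by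
    rintro a l ⟨x, y⟩
    exact congrArg (fun z => Amalg.mk z y) (smul_comm a (l, (1 : G)) x)

/-- The points of the amalgamated product on which `A` acts freely. -/
def TensorCarrier (X : FiberedSet A (L × G)) (Y : FiberedSet A G) : Type u :=
  {q : Amalg X Y // ∀ a : A, a • q = q → a = 1}

instance (X : FiberedSet A (L × G)) (Y : FiberedSet A G) : MulAction A (TensorCarrier X Y) where
  smul a q := ⟨a • q.1, fun b hb => q.2 b (by
    rwa [smul_comm b a, smul_left_cancel_iff] at hb)⟩
  one_smul q := Subtype.ext (one_smul A q.1)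
  mul_smul a b q := Subtype.ext (mul_smul a b q.1)

instance (X : FiberedSet A (L × G)) (Y : FiberedSet A G) : MulAction L (TensorCarrier X Y) where
  smul l q := ⟨l • q.1, fun b hb => q.2 b (by
    rwa [smul_comm b l, smul_left_cancel_iff] at hb)⟩
  one_smul q := Subtype.ext (one_smul L q.1)
  mul_smul a b q := Subtype.ext (mul_smul a b q.1)

instance (X : FiberedSet A (L × G)) (Y : FiberedSet A G) :
    SMulCommClass A L (TensorCarrier X Y) where
  smul_comm a l q := Subtype.ext (smul_comm a l q.1)

theorem tensor_finite (X : FiberedSet A (L × G)) (Y : FiberedSet A G) :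
    Finite (MulAction.orbitRel.Quotient A (TensorCarrier X Y)) := by
  choose rx ry hr using fun t : TensorCarrier X Y => Amalg.exists_rep t.1
  refine Finite.of_injective
    (fun q : MulAction.orbitRel.Quotient A (TensorCarrier X Y) =>
      ((Quotient.mk'' (rx q.out) : Fibers X), (Quotient.mk'' (ry q.out) : Fibers Y))) ?_
  intro q q' h
  obtain ⟨h1, h2⟩ := Prod.mk.inj h
  obtain ⟨a, ha⟩ := (mk_eq_mk_iff _ _).1 h1
  obtain ⟨b, hb⟩ := (mk_eq_mk_iff _ _).1 h2
  rw [← q.out_eq, ← q'.out_eq]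
  refine Quotient.sound ⟨b * a, Subtype.ext ?_⟩
  change (b * a) • q'.out.1 = q.out.1
  rw [hr q.out, hr q'.out, ← ha, ← hb, Amalg.mk_smul, ← Amalg.smulA_mk, mul_smul]

/-- The tensor product `X ⊗_{AG} Y` of an `A`-fibered `(L, G)`-biset and an `A`-fibered `G`-set. -/
def tensor (X : FiberedSet A (L × G)) (Y : FiberedSet A G) : FiberedSet A L where
  carrier := TensorCarrier X Y
  free a q h := q.2 a (congrArg Subtype.val h)
  finite := tensor_finite X Y

/-- An equivariant bijection of amalgamated products gives an isomorphism of tensor products. -/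
theorem isom_tensor_of_amalg {X : FiberedSet A (L × G)} {Y Z : FiberedSet A G}
    (f : Amalg X Y ≃ Amalg X Z) (hA : ∀ (a : A) q, f (a • q) = a • f q)
    (hL : ∀ (l : L) q, f (l • q) = l • f q) : Isom (tensor X Y) (tensor X Z) := by
  refine ⟨f.subtypeEquiv fun q => forall_congr' fun a => ?_,
    fun a q => Subtype.ext (hA a q.1), fun l q => Subtype.ext (hL l q.1)⟩
  rw [← hA, f.apply_eq_iff_eq]

theorem tensor_iso (X : FiberedSet A (L × G)) {Y Z : FiberedSet A G} (h : Isom Y Z) :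
    Isom (tensor X Y) (tensor X Z) := by
  obtain ⟨f, hA, hG⟩ := h
  refine isom_tensor_of_amalg
    (Quotient.congr ((Equiv.refl X.carrier).prodCongr f) ?_ : Amalg X Y ≃ Amalg X Z) ?_ ?_
  · rintro ⟨x, y⟩ ⟨x', y'⟩
    refine exists_congr fun a => exists_congr fun g => and_congr Iff.rfl ?_
    change y' = a • g • y ↔ f y' = a • g • f y
    rw [← hG, ← hA, f.apply_eq_iff_eq]
  · rintro a ⟨x, y⟩; rfl
  · rintro a ⟨x, y⟩; rfl

/-- The amalgamated product distributes over disjoint unions. -/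
def amalgSum (X : FiberedSet A (L × G)) (Y Z : FiberedSet A G) :
    Amalg X (disjUnion Y Z) ≃ Amalg X Y ⊕ Amalg X Z where
  toFun := Quotient.lift
    (fun s : X.carrier × (Y.carrier ⊕ Z.carrier) =>
      Sum.map (fun y => (Amalg.mk s.1 y : Amalg X Y)) (fun z => (Amalg.mk s.1 z : Amalg X Z)) s.2)
    (by
      rintro ⟨x, y | y⟩ ⟨x', y' | y'⟩ ⟨a, h, h1, h2⟩ <;> cases h2
      · exact congrArg Sum.inl (Amalg.mk_eq.2 ⟨a, h, h1, rfl⟩)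
      · exact congrArg Sum.inr (Amalg.mk_eq.2 ⟨a, h, h1, rfl⟩))
  invFun := Sum.elim
    (Quotient.lift (fun s => (Amalg.mk s.1 (Sum.inl s.2) : Amalg X (disjUnion Y Z))) (by
      rintro s t ⟨a, h, h1, h2⟩
      exact Amalg.mk_eq.2 ⟨a, h, h1, congrArg Sum.inl h2⟩))
    (Quotient.lift (fun s => (Amalg.mk s.1 (Sum.inr s.2) : Amalg X (disjUnion Y Z))) (by
      rintro s t ⟨a, h, h1, h2⟩
      exact Amalg.mk_eq.2 ⟨a, h, h1, congrArg Sum.inr h2⟩))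
  left_inv := by
    rintro ⟨x, y | y⟩ <;> rfl
  right_inv := by
    rintro (⟨x, y⟩ | ⟨x, y⟩) <;> rfl

theorem amalgSum_smulA (X : FiberedSet A (L × G)) (Y Z : FiberedSet A G) (a : A)
    (q : Amalg X (disjUnion Y Z)) : amalgSum X Y Z (a • q) = a • amalgSum X Y Z q := by
  obtain ⟨x, y | y, rfl⟩ := Amalg.exists_rep q <;> rfl

theorem amalgSum_smulL (X : FiberedSet A (L × G)) (Y Z : FiberedSet A G) (l : L)
    (q : Amalg X (disjUnion Y Z)) : amalgSum X Y Z (l • q) = l • amalgSum X Y Z q := by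
  obtain ⟨x, y | y, rfl⟩ := Amalg.exists_rep q <;> rfl

theorem tensor_disjUnion (X : FiberedSet A (L × G)) (Y Z : FiberedSet A G) :
    Isom (tensor X (disjUnion Y Z)) (disjUnion (tensor X Y) (tensor X Z)) := by
  let j : (disjUnion (tensor X Y) (tensor X Z)).carrier → TensorCarrier X (disjUnion Y Z) :=
    Sum.elim
      (fun t => ⟨(amalgSum X Y Z).symm (Sum.inl t.1), fun a ha => t.2 a (by
        have := congrArg (amalgSum X Y Z) ha
        rw [amalgSum_smulA, Equiv.apply_symm_apply] at this
        exact Sum.inl_injective this)⟩)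
      (fun t => ⟨(amalgSum X Y Z).symm (Sum.inr t.1), fun a ha => t.2 a (by
        have := congrArg (amalgSum X Y Z) ha
        rw [amalgSum_smulA, Equiv.apply_symm_apply] at this
        exact Sum.inr_injective this)⟩)
  have hval : ∀ t, amalgSum X Y Z (j t).1 = Sum.map Subtype.val Subtype.val t := by
    rintro (t | t) <;> exact Equiv.apply_symm_apply _ _
  have hext : ∀ q q' : TensorCarrier X (disjUnion Y Z),
      amalgSum X Y Z q.1 = amalgSum X Y Z q'.1 → q = q' :=
    fun q q' h => Subtype.ext ((amalgSum X Y Z).injective h)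
  have hbij : Function.Bijective j := by
    constructor
    · intro s t h
      have := congrArg (fun q : TensorCarrier X (disjUnion Y Z) => amalgSum X Y Z q.1) h
      simp only [hval] at this
      exact Sum.map_injective.2 ⟨Subtype.val_injective, Subtype.val_injective⟩ this
    · intro q
      rcases hq : amalgSum X Y Z q.1 with s | s
      · refine ⟨Sum.inl ⟨s, fun a ha => q.2 a ((amalgSum X Y Z).injective ?_)⟩,
          hext _ _ ((hval _).trans hq.symm)⟩
        rw [amalgSum_smulA, hq]
        exact congrArg Sum.inl ha
      · refine ⟨Sum.inr ⟨s, fun a ha => q.2 a ((amalgSum X Y Z).injective ?_)⟩,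
          hext _ _ ((hval _).trans hq.symm)⟩
        rw [amalgSum_smulA, hq]
        exact congrArg Sum.inr ha
  have hjA : ∀ (a : A) t, j (a • t) = a • j t := by
    intro a t
    refine hext _ _ ((hval _).trans ?_)
    change _ = amalgSum X Y Z (a • (j t).1)
    rw [amalgSum_smulA, hval]
    rcases t with t | t <;> rfl
  have hjL : ∀ (l : L) t, j (l • t) = l • j t := by
    intro a t
    refine hext _ _ ((hval _).trans ?_)
    change _ = amalgSum X Y Z (a • (j t).1)
    rw [amalgSum_smulL, hval]
    rcases t with t | t <;> rfl
  exact isom_symm ⟨Equiv.ofBijective j hbij, hjA, hjL⟩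

variable (k) in
/-- The map `k B^A(G) → k B^A(L)`, `[Y] ↦ [X ⊗_{AG} Y]`, given by an `A`-fibered
`(L, G)`-biset `X`. -/
def bisetMap (X : FiberedSet A (L × G)) : kB A G k →ₗ[k] kB A L k :=
  lift k (fun Y => cls k (tensor X Y)) (fun _ _ h => cls_iso k (tensor_iso X h))
    (fun Y Z => (cls_iso k (tensor_disjUnion X Y Z)).trans (cls_disjUnion k _ _))

/-! ### Deflation -/

/-- The underlying set of the `A`-fibered biset attached to a set `S`. -/
structure Fibered (A S : Type u) where
  fib : A
  pt : S

instance (S : Type u) : MulAction A (Fibered A S) where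
  smul a x := ⟨a * x.fib, x.pt⟩
  one_smul x := congrArg (fun b => Fibered.mk b x.pt) (one_mul x.fib)
  mul_smul a b x := congrArg (fun c => Fibered.mk c x.pt) (mul_assoc a b x.fib)

/-- The action of `G` on `A × S` through `S`. -/
abbrev fiberedAction (S : Type u) [MulAction G S] : MulAction G (Fibered A S) where
  smul g x := ⟨x.fib, g • x.pt⟩
  one_smul x := congrArg (Fibered.mk x.fib) (one_smul G x.pt)
  mul_smul g h x := congrArg (Fibered.mk x.fib) (mul_smul g h x.pt)

variable (A) in
/-- The `A`-fibered `G`-set `A × S` attached to a finite `G`-set `S`; `G` acts trivially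
on `A`. -/
def ofGSet (S : Type u) [MulAction G S] [Finite S] : FiberedSet A G where
  carrier := Fibered A S
  actG := fiberedAction S
  comm :=
    letI : MulAction G (Fibered A S) := fiberedAction S
    ⟨fun _ _ _ => rfl⟩
  free a x h := mul_eq_right.1 (congrArg (Fibered.fib (S := S)) h)
  finite := by
    refine Finite.of_surjective (α := S) (fun s => Quotient.mk'' (Fibered.mk 1 s)) ?_
    intro q
    obtain ⟨x, rfl⟩ := Quotient.exists_rep q
    obtain ⟨a, s⟩ : Fibered A S := x
    refine ⟨s, Quotient.sound ⟨a⁻¹, ?_⟩⟩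
    exact congrArg (fun c => Fibered.mk c s) (inv_mul_cancel a)

/-- The set `G/N`, to be regarded as a `(G/N, G)`-biset by left and right multiplication. -/
structure DefSet (N : Subgroup G) where
  pt : G ⧸ N

/-- The element `(c, g)` of `G/N × G` sends `d` to `c d (gN)⁻¹`. -/
instance (N : Subgroup G) [N.Normal] : MulAction ((G ⧸ N) × G) (DefSet N) where
  smul s d := ⟨s.1 * d.pt * (s.2 : G ⧸ N)⁻¹⟩
  one_smul d := congrArg DefSet.mk (by
    change (1 : G ⧸ N) * d.pt * ((1 : G) : G ⧸ N)⁻¹ = d.pt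
    simp)
  mul_smul s t d := congrArg DefSet.mk (by
    change s.1 * t.1 * d.pt * ((s.2 * t.2 : G) : G ⧸ N)⁻¹ =
      s.1 * (t.1 * d.pt * (t.2 : G ⧸ N)⁻¹) * (s.2 : G ⧸ N)⁻¹
    simp [mul_assoc])

instance (N : Subgroup G) [Finite G] : Finite (DefSet N) :=
  Finite.of_injective DefSet.pt fun ⟨_⟩ ⟨_⟩ h => congrArg DefSet.mk h

variable (A k) in
/-- The deflation map `Def^G_{G/N} : k B^A(G) → k B^A(G/N)`. -/
def deflation [Finite G] (N : Subgroup G) [N.Normal] : kB A G k →ₗ[k] kB A (G ⧸ N) k :=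
  bisetMap k (ofGSet A (G := (G ⧸ N) × G) (DefSet N))

end basics

end

end FiberedBurnside

open FiberedBurnside

namespace FiberedBurnside

open scoped Classical

noncomputable section

/-! ### Transitive fibered sets: stabilizer and character of a fiber. -/

section transitive

variable {A G : Type u} [CommGroup A] [Group G]

/-! For abelian `G`, a transitive `A`-fibered `G`-set is determined by a subgroup `V` (the
stabilizer of a fiber) and a character `φ : V → A` (`isom_of_generates`), and its species at `(K,
l)` is `[G : V] φ(l)` if `K ≤ V` and zero otherwise. When `A` has enough roots of unity, all
conjugacy and all subgroups `O(K)` are trivial. Fourier inversion over the characters of `G` and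
Möbius inversion over its subgroups then yield elements with prescribed species at each pair
(`species_idem`). These span, so the species separate points (`eq_of_species`). This gives existence
and uniqueness of the idempotents and reduces the formula to a comparison of species.

Let `H = ⟨h⟩` have order `p`, let `K'` be the preimage of `K ≤ G/H`, and write `m = l * h ^ i`. The
key identity (`species_deflation`) is `p * s_{K, lH}(Def x) = ∑_{i < p} (s_{K', m}(x) + ∑_L (s_{L,
m}(x) - s_{K', m}(x)))`, where `L` runs over the complements of `H` in `K'` that contain `m`. It
suffices to check it on transitive sets. If `h ∈ V`, the inner sum vanishes and summing the powers
of `φ(h)` tests whether `A` still acts freely after deflation. If `h ∉ V`, the terms at `K'` vanish,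
and the only complement inside `V` can be `K' ∩ V`.

On the idempotent at `(G, g)` a complement `L` contributes nothing by itself because it is proper,
so the factor is `(1 - c) / p`, with `c` the number of complements of `H` in `G` that contain `g`
(`deflation_isIdempotentAt`). If `h ∉ ⟨g⟩`, these complements correspond to the characters with
value `1` at `g` and a fixed nontrivial value at `h`, so `c = [G : ⟨g, h⟩]` (`card_complements`). If
`1 ≠ g ∈ H`, there are none. -/

theorem fiberChar_eq {X : FiberedSet A G} {g : G} {a : A} {x : X.carrier} (h : g • x = a • x) :
    fiberChar g x = a := by
  have h1 : g • x = (fiberChar g x : A) • x :=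
    Classical.epsilon_spec (p := fun a : A => g • x = a • x) ⟨a, h⟩
  rw [h] at h1
  have h2 := X.free (a⁻¹ * fiberChar g x) x (by rw [mul_smul, ← h1, inv_smul_smul])
  rw [inv_mul_eq_one] at h2
  exact h2.symm

/-- The stabilizer of the fiber `A x`. -/
def fiberStab {X : FiberedSet A G} (x : X.carrier) : Subgroup G where
  carrier := {g | ∃ a : A, g • x = a • x}
  one_mem' := ⟨1, by simp⟩
  mul_mem' := by
    rintro g h ⟨a, ha⟩ ⟨b, hb⟩
    exact ⟨b * a, by rw [mul_smul, hb, ← smul_comm, ha, smul_smul]⟩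
  inv_mem' := by
    rintro g ⟨a, ha⟩
    refine ⟨a⁻¹, ?_⟩
    rw [inv_smul_eq_iff, ← smul_comm, ha, inv_smul_smul]

theorem mem_fiberStab {X : FiberedSet A G} {x : X.carrier} {g : G} :
    g ∈ fiberStab x ↔ ∃ a : A, g • x = a • x := Iff.rfl

theorem smul_eq_fiberChar_smul {X : FiberedSet A G} {x : X.carrier} {g : G}
    (h : g ∈ fiberStab x) : g • x = (fiberChar g x : A) • x := by
  obtain ⟨a, ha⟩ := h
  rw [fiberChar_eq ha, ha]

theorem smul_eq_smul_iff {X : FiberedSet A G} {x : X.carrier} {g : G} {a : A} :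
    g • x = a • x ↔ g ∈ fiberStab x ∧ fiberChar g x = a :=
  ⟨fun h => ⟨⟨a, h⟩, fiberChar_eq h⟩, fun h => h.2 ▸ smul_eq_fiberChar_smul h.1⟩

/-- The homomorphism `φ_x` from the stabilizer of the fiber `A x` to `A`. -/
def fiberHom {X : FiberedSet A G} (x : X.carrier) : fiberStab x →* A where
  toFun g := fiberChar (g : G) x
  map_one' := fiberChar_eq (by simp)
  map_mul' g h := by
    refine fiberChar_eq ?_
    rw [Subgroup.coe_mul, mul_smul, smul_eq_fiberChar_smul h.2, ← smul_comm,
      smul_eq_fiberChar_smul g.2, smul_smul, mul_comm]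

/-- `X` is the `A × G`-orbit of `x`. -/
def Generates {X : FiberedSet A G} (x : X.carrier) : Prop :=
  ∀ y : X.carrier, ∃ (a : A) (g : G), y = a • g • x

theorem smul_smul_eq_iff {X : FiberedSet A G} (x : X.carrier) (a b : A) (g h : G) :
    a • g • x = b • h • x ↔ (h⁻¹ * g) • x = (a⁻¹ * b) • x := by
  rw [mul_smul, mul_smul, inv_smul_eq_iff, ← smul_comm a⁻¹, eq_inv_smul_iff, ← smul_comm b]

/-- Transitive fibered sets with the same stabilizer and the same character are isomorphic. -/
theorem isom_of_generates {X Y : FiberedSet A G} {x : X.carrier} {y : Y.carrier}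
    (hx : Generates x) (hy : Generates y)
    (hxy : ∀ (g : G) (a : A), g • x = a • x ↔ g • y = a • y) : Isom X Y := by
  choose a g hag using hx
  -- Coincidences in the orbit of `x` depend only on stabilizer and character, so `b • h • x ↦ b • h
  -- • y` is well defined and injective.
  have key : ∀ (b b' : A) (h h' : G), b • h • x = b' • h' • x ↔ b • h • y = b' • h' • y := by
    intro b b' h h'
    rw [smul_smul_eq_iff, smul_smul_eq_iff, hxy]
  have hf : ∀ (b : A) (h : G), a (b • h • x) • g (b • h • x) • y = b • h • y := fun b h =>
    (key _ _ _ _).1 (hag _).symm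
  refine ⟨Equiv.ofBijective (fun z => a z • g z • y) ⟨fun z w hzw => ?_, fun w => ?_⟩, ?_, ?_⟩
  · rw [hag z, hag w]
    exact (key _ _ _ _).2 hzw
  · obtain ⟨b, h, rfl⟩ := hy w
    exact ⟨b • h • x, hf b h⟩
  · intro c z
    change a (c • z) • g (c • z) • y = c • a z • g z • y
    conv_lhs => rw [hag z, smul_smul c, hf]
    rw [mul_smul]
  · intro c z
    change a (c • z) • g (c • z) • y = c • a z • g z • y
    conv_lhs => rw [hag z, ← smul_comm (a z) c, smul_smul c, hf]
    rw [mul_smul, smul_comm (a z) c]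

/-- The fibers of a transitive fibered set are the cosets of the stabilizer of a fiber. -/
def fibersEquiv {X : FiberedSet A G} {x : X.carrier} (hx : Generates x) :
    G ⧸ fiberStab x ≃ Fibers X :=
  Equiv.ofBijective
    (Quotient.lift (fun g : G => (Quotient.mk'' (g • x) : Fibers X)) (by
      intro g h hgh
      obtain ⟨a, ha⟩ := QuotientGroup.leftRel_apply.1 hgh
      refine ((mk_eq_mk_iff _ _).2 ⟨a, ?_⟩).symm
      rw [smul_comm, ← ha, smul_smul, mul_inv_cancel_left]))
    (by
      constructor
      · rintro ⟨g⟩ ⟨h⟩ hgh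
        obtain ⟨a, ha⟩ := (mk_eq_mk_iff _ _).1 hgh.symm
        refine Quotient.sound (QuotientGroup.leftRel_apply.2 ⟨a, ?_⟩)
        rw [mul_smul, ← ha, ← smul_comm, inv_smul_smul]
      · rintro ⟨y⟩
        obtain ⟨a, g, rfl⟩ := hx y
        exact ⟨QuotientGroup.mk g, (mk_eq_mk_iff _ _).2 ⟨a⁻¹, inv_smul_smul _ _⟩⟩)

theorem card_fibers {X : FiberedSet A G} {x : X.carrier} (hx : Generates x) :
    Nat.card (Fibers X) = (fiberStab x).index :=
  (Nat.card_congr (fibersEquiv hx)).symm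

end transitive

/-! ### Transitive fibered sets over an abelian group and their species. -/

section commutative

variable {A G : Type u} [CommGroup A] [CommGroup G] {k : Type v} [Field k]

/-- Since `G` is commutative, every fiber of the orbit has the stabilizer and character of the fiber
of `x`; hence all fibers contribute equally. -/
theorem speciesVal_of_generates (ι : A →* kˣ) {X : FiberedSet A G} {x : X.carrier}
    (hx : Generates x) (K : Subgroup G) (l : G) :
    speciesVal ι K l X =
      if K ≤ fiberStab x then (fiberStab x).index * (ι (fiberChar l x) : k) else 0 := by
  have hterm : ∀ q : Fibers X, fiberTerm ι K l X q = fiberTerm ι K l X (Quotient.mk'' x) := by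
    rintro ⟨y⟩
    obtain ⟨a, g, rfl⟩ := hx y
    refine fiberTerm_congr ι K l _ _ fun h b => ?_
    rw [smul_eq_iff, smul_smul, mul_comm, mul_smul, smul_comm b g, smul_left_cancel_iff]
  have := Fintype.ofFinite (Fibers X)
  rw [speciesVal, finsum_eq_sum_of_fintype, Finset.sum_congr rfl fun q _ => hterm q,
    Finset.sum_const, Finset.card_univ, ← Nat.card_eq_fintype_card, card_fibers hx, nsmul_eq_mul]
  change _ * (if K ≤ fiberStab x then (ι (fiberChar l x) : k) else 0) = _
  split_ifs <;> simp

/-- The action of `G` on `A × G/V` twisted by `ψ`. -/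
abbrev twistedAction (V : Subgroup G) (ψ : G →* A) : MulAction G (Fibered A (G ⧸ V)) where
  smul g x := ⟨ψ g * x.fib, g • x.pt⟩
  one_smul x := by
    change Fibered.mk (ψ 1 * x.fib) ((1 : G) • x.pt) = x
    rw [map_one, one_mul, one_smul]
  mul_smul g h x := by
    change Fibered.mk (ψ (g * h) * x.fib) ((g * h) • x.pt) = ⟨ψ g * (ψ h * x.fib), g • h • x.pt⟩
    rw [map_mul, mul_assoc, mul_smul]

/-- The transitive `A`-fibered `G`-set `A × G/V` with the action of `G` twisted by `ψ`. -/
def twisted [Finite G] (V : Subgroup G) (ψ : G →* A) : FiberedSet A G where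
  carrier := Fibered A (G ⧸ V)
  actG := twistedAction V ψ
  comm :=
    letI : MulAction G (Fibered A (G ⧸ V)) := twistedAction V ψ
    ⟨fun a g x => congrArg (fun b => Fibered.mk b (g • x.pt)) (mul_left_comm a (ψ g) x.fib)⟩
  free := (ofGSet A (G := G) (G ⧸ V)).free
  finite := (ofGSet A (G := G) (G ⧸ V)).finite

/-- The base point of `twisted V ψ`. -/
def twistedBase [Finite G] (V : Subgroup G) (ψ : G →* A) : (twisted V ψ).carrier :=
  Fibered.mk 1 (QuotientGroup.mk 1)

theorem twistedBase_generates [Finite G] (V : Subgroup G) (ψ : G →* A) :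
    Generates (twistedBase V ψ) := by
  rintro ⟨a, ⟨g⟩⟩
  refine ⟨a * (ψ g)⁻¹, g, ?_⟩
  change Fibered.mk a (QuotientGroup.mk g) =
    Fibered.mk (a * (ψ g)⁻¹ * (ψ g * 1)) (QuotientGroup.mk (g * 1))
  simp

theorem smul_twistedBase [Finite G] (V : Subgroup G) (ψ : G →* A) (g : G) (a : A) :
    g • twistedBase V ψ = a • twistedBase V ψ ↔ g ∈ V ∧ ψ g = a := by
  change Fibered.mk (ψ g * 1) (QuotientGroup.mk (g * 1)) =
    Fibered.mk (a * 1) (QuotientGroup.mk 1) ↔ _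
  rw [Fibered.mk.injEq, and_comm, mul_one, mul_one, mul_one, QuotientGroup.mk_one,
    QuotientGroup.eq_one_iff]

theorem fiberStab_twistedBase [Finite G] (V : Subgroup G) (ψ : G →* A) :
    fiberStab (twistedBase V ψ) = V := by
  ext g
  simp [mem_fiberStab, smul_twistedBase]

theorem speciesVal_twisted [Finite G] (ι : A →* kˣ) (V : Subgroup G) (ψ : G →* A)
    (K : Subgroup G) {l : G} (hl : l ∈ K) :
    speciesVal ι K l (twisted V ψ) = if K ≤ V then V.index * (ι (ψ l) : k) else 0 := by
  rw [speciesVal_of_generates ι (twistedBase_generates V ψ), fiberStab_twistedBase]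
  split_ifs with h
  · rw [fiberChar_eq ((smul_twistedBase V ψ l _).2 ⟨h hl, rfl⟩)]
  · rfl

end commutative

/-! ### Decomposition into orbits. -/

section decomposition

variable {A G : Type u} [CommGroup A] [Group G]

/-- The fibered subset of `X` on an invariant set of points. -/
def sub (X : FiberedSet A G) (S : Set X.carrier) (hA : ∀ (a : A), ∀ x ∈ S, a • x ∈ S)
    (hG : ∀ (g : G), ∀ x ∈ S, g • x ∈ S) : FiberedSet A G where
  carrier := S
  actA :=
    { smul := fun a x => ⟨a • x.1, hA a x.1 x.2⟩
      one_smul := fun x => Subtype.ext (one_smul A x.1)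
      mul_smul := fun a b x => Subtype.ext (mul_smul a b x.1) }
  actG :=
    { smul := fun a x => ⟨a • x.1, hG a x.1 x.2⟩
      one_smul := fun x => Subtype.ext (one_smul G x.1)
      mul_smul := fun a b x => Subtype.ext (mul_smul a b x.1) }
  comm := by
    let _ : MulAction A S :=
      { smul := fun a x => ⟨a • x.1, hA a x.1 x.2⟩
        one_smul := fun x => Subtype.ext (one_smul A x.1)
        mul_smul := fun a b x => Subtype.ext (mul_smul a b x.1) }
    let _ : MulAction G S :=
      { smul := fun a x => ⟨a • x.1, hG a x.1 x.2⟩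
        one_smul := fun x => Subtype.ext (one_smul G x.1)
        mul_smul := fun a b x => Subtype.ext (mul_smul a b x.1) }
    exact ⟨fun a g x => Subtype.ext (smul_comm a g x.1)⟩
  free a x h := X.free a x.1 (congrArg Subtype.val h)
  finite := by
    let _ : MulAction A S :=
      { smul := fun a x => ⟨a • x.1, hA a x.1 x.2⟩
        one_smul := fun x => Subtype.ext (one_smul A x.1)
        mul_smul := fun a b x => Subtype.ext (mul_smul a b x.1) }
    refine Finite.of_injective
      (fun q : MulAction.orbitRel.Quotient A S => (Quotient.mk'' q.out.1 : Fibers X)) ?_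
    intro q q' h
    obtain ⟨a, ha⟩ := (mk_eq_mk_iff _ _).1 h
    rw [← q.out_eq, ← q'.out_eq]
    exact Quotient.sound ⟨a, Subtype.ext ha⟩

theorem isom_sub_compl (X : FiberedSet A G) (S : Set X.carrier)
    (hA : ∀ (a : A), ∀ x ∈ S, a • x ∈ S) (hG : ∀ (g : G), ∀ x ∈ S, g • x ∈ S)
    (hA' : ∀ (a : A), ∀ x ∈ Sᶜ, a • x ∈ Sᶜ) (hG' : ∀ (g : G), ∀ x ∈ Sᶜ, g • x ∈ Sᶜ) :
    Isom (disjUnion (sub X S hA hG) (sub X Sᶜ hA' hG')) X := by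
  refine ⟨Equiv.Set.sumCompl S, ?_, ?_⟩
  · rintro a (x | x) <;> rfl
  · rintro a (x | x) <;> rfl

theorem cls_of_isEmpty (k : Type v) [Field k] (X : FiberedSet A G) [IsEmpty X.carrier] :
    cls k X = 0 := by
  have h : Isom (disjUnion X X) X := by
    have : IsEmpty (disjUnion X X).carrier := inferInstanceAs (IsEmpty (X.carrier ⊕ X.carrier))
    exact ⟨Equiv.equivOfIsEmpty _ _, fun _ x => isEmptyElim x, fun _ x => isEmptyElim x⟩
  have h2 := (cls_disjUnion k X X).symm.trans (cls_iso k h)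
  simpa using h2

/-- A submodule of `k B^A(G)` containing the classes of all transitive fibered sets contains the
classes of all fibered sets. -/
theorem cls_mem_of_generates {k : Type v} [Field k] (S : Submodule k (kB A G k))
    (h : ∀ (X : FiberedSet A G) (x : X.carrier), Generates x → cls k X ∈ S)
    (X : FiberedSet A G) : cls k X ∈ S := by
  induction hn : Nat.card (Fibers X) using Nat.strong_induction_on generalizing X with
  | _ n ih =>
  rcases isEmpty_or_nonempty X.carrier with hX | ⟨⟨x⟩⟩
  · rw [cls_of_isEmpty]
    exact S.zero_mem
  -- The orbit of `x` is split off; its complement has fewer fibers, because it misses the fiber of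
  -- `x`.
  · let T : Set X.carrier := {y | ∃ (a : A) (g : G), y = a • g • x}
    have hA : ∀ (a : A) (y), a • y ∈ T ↔ y ∈ T := by
      intro a y
      constructor
      · rintro ⟨b, g, hb⟩
        exact ⟨a⁻¹ * b, g, by rw [mul_smul, ← hb, inv_smul_smul]⟩
      · rintro ⟨b, g, rfl⟩
        exact ⟨a * b, g, by rw [mul_smul]⟩
    have hG : ∀ (a : G) (y), a • y ∈ T ↔ y ∈ T := by
      intro a y
      constructor
      · rintro ⟨b, g, hb⟩
        exact ⟨b, a⁻¹ * g, by rw [mul_smul, smul_comm b, ← hb, inv_smul_smul]⟩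
      · rintro ⟨b, g, rfl⟩
        exact ⟨b, a * g, by rw [mul_smul, smul_comm b a]⟩
    have e := isom_sub_compl X T (fun a y => (hA a y).2) (fun a y => (hG a y).2)
      (fun a y => mt (hA a y).1) (fun a y => mt (hG a y).1)
    rw [← cls_iso k e, cls_disjUnion]
    have hxT : x ∈ T := ⟨1, 1, by simp⟩
    refine S.add_mem (h _ (⟨x, hxT⟩ : T) ?_) (ih _ ?_ _ rfl)
    · rintro ⟨y, a, g, rfl⟩
      exact ⟨a, g, rfl⟩
    · subst hn
      set Y := sub X Tᶜ (fun a y => mt (hA a y).1) (fun a y => mt (hG a y).1) with hY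
      let j : Fibers Y → Fibers X := Quotient.map' (fun y : Y.carrier => (y.1 : X.carrier)) (by
        rintro s t ⟨a, rfl⟩
        exact ⟨a, rfl⟩)
      have := Fintype.ofFinite (Fibers X)
      have := Fintype.ofFinite (Fibers Y)
      rw [Nat.card_eq_fintype_card, Nat.card_eq_fintype_card]
      refine Fintype.card_lt_of_injective_of_notMem j (b := Quotient.mk'' x) ?_ ?_
      · rintro ⟨s⟩ ⟨t⟩ hst
        obtain ⟨a, ha⟩ := (mk_eq_mk_iff _ _).1 hst
        exact Quotient.sound ⟨a, Subtype.ext ha⟩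
      · rintro ⟨⟨s⟩, hs⟩
        obtain ⟨a, ha⟩ := (mk_eq_mk_iff _ _).1 hs
        have hs' : a • x = s.1 := ha
        exact s.2 (hs' ▸ (hA a x).2 hxT)

theorem span_cls (k : Type v) [Field k] :
    Submodule.span k (Set.range (cls (A := A) (G := G) k)) = ⊤ := by
  rw [eq_top_iff]
  rintro ⟨x⟩ -
  change Submodule.Quotient.mk x ∈ _
  induction x using Finsupp.induction_linear with
  | zero => exact Submodule.zero_mem _
  | add x y hx hy => exact Submodule.add_mem _ hx hy
  | single X c =>
    rw [← mul_one c, ← smul_eq_mul, ← Finsupp.smul_single]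
    exact Submodule.smul_mem _ c (Submodule.subset_span (Set.mem_range_self X))

/-- Linear maps on `k B^A(G)` agreeing on transitive fibered sets are equal. -/
theorem kB_hom_ext {k : Type v} [Field k] {M : Type*} [AddCommGroup M] [Module k M]
    {f f' : kB A G k →ₗ[k] M}
    (h : ∀ (X : FiberedSet A G) (x : X.carrier), Generates x → f (cls k X) = f' (cls k X)) :
    f = f' := by
  refine LinearMap.ext_on_range (span_cls k) fun X => ?_
  exact cls_mem_of_generates (LinearMap.eqLocus f f') h X

end decomposition

/-! ### Duality of finite abelian groups with values in `A`. -/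

section duality

variable {A G : Type u} [CommGroup A] [CommGroup G] [Finite G]
  [HasEnoughRootsOfUnity A (Monoid.exponent G)]

variable (A) in
theorem exists_hom_apply_ne_one_of_notMem (V : Subgroup G) {x : G} (hx : x ∉ V) :
    ∃ ψ : G →* A, (∀ v ∈ V, ψ v = 1) ∧ ψ x ≠ 1 := by
  by_contra! h
  refine hx ((CommGroup.forall_monoidHom_apply_eq_one_iff A V x).1 fun φ hφ => ?_)
  have := h ((toUnits : A ≃* Aˣ).symm.toMonoidHom.comp φ) fun v hv => by simp [hφ v hv]
  simpa using this

theorem exists_hom_extension (V : Subgroup G) (φ : V →* A) :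
    ∃ ψ : G →* A, ∀ v : V, ψ v = φ v := by
  obtain ⟨ψ, hψ⟩ := MonoidHom.domRestrict_surjective A V ((toUnits : A ≃* Aˣ).toMonoidHom.comp φ)
  refine ⟨(toUnits : A ≃* Aˣ).symm.toMonoidHom.comp ψ, fun v => ?_⟩
  have h := DFunLike.congr_fun hψ v
  change ψ v = toUnits (φ v) at h
  simp [h]

variable (A G) in
theorem card_hom : Nat.card (G →* A) = Nat.card G := by
  rw [← CommGroup.card_monoidHom_of_hasEnoughRootsOfUnity G A]
  exact Nat.card_congr (toUnits : A ≃* Aˣ).monoidHomCongrRight.toEquiv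

variable (A G) in
theorem finite_hom : Finite (G →* A) :=
  Nat.finite_of_card_ne_zero (by rw [card_hom]; exact Nat.card_pos.ne')

variable {k : Type v} [Field k] (ι : A →* kˣ) (hι : Function.Injective ι)
include hι

omit [Finite G] [HasEnoughRootsOfUnity A (Monoid.exponent G)] in
-- Translation by an `x` with `ψ x ≠ 1` multiplies the sum by `ι (ψ x)`, which differs from `1` as
-- `ι` is injective; so the sum is zero.
theorem sum_apply_eq [Fintype G] (ψ : G →* A) :
    ∑ g, (ι (ψ g) : k) = if ψ = 1 then (Nat.card G : k) else 0 := by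
  split_ifs with h
  · simp [h, Nat.card_eq_fintype_card]
  · obtain ⟨x, hx⟩ : ∃ x, ψ x ≠ 1 := by
      by_contra! h'
      exact h (MonoidHom.ext h')
    have h1 : (ι (ψ x) : k) * ∑ g, (ι (ψ g) : k) = ∑ g, (ι (ψ g) : k) := by
      rw [Finset.mul_sum]
      refine Fintype.sum_equiv (Equiv.mulLeft x) _ _ fun g => ?_
      simp
    by_contra h0
    have h2 := mul_right_cancel₀ h0 (h1.trans (one_mul _).symm)
    exact hx (hι (by rw [map_one]; exact Units.ext h2))

/-- The dual orthogonality relation, by the same translation argument with a character that is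
nontrivial at `g`. -/
theorem sum_hom_apply [Fintype (G →* A)] (g : G) :
    ∑ ψ : G →* A, (ι (ψ g) : k) = if g = 1 then (Nat.card G : k) else 0 := by
  split_ifs with h
  · simp [h, ← card_hom A G, Nat.card_eq_fintype_card]
  · obtain ⟨χ, -, hχ⟩ := exists_hom_apply_ne_one_of_notMem A ⊥ (x := g) (by simpa using h)
    have h1 : (ι (χ g) : k) * ∑ ψ : G →* A, (ι (ψ g) : k) = ∑ ψ : G →* A, (ι (ψ g) : k) := by
      rw [Finset.mul_sum]
      refine Fintype.sum_equiv (Equiv.mulLeft χ) _ _ fun g => ?_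
      simp
    by_contra h0
    have h2 := mul_right_cancel₀ h0 (h1.trans (one_mul _).symm)
    exact hχ (hι (by rw [map_one]; exact Units.ext h2))

end duality

/-! ### Construction of the idempotents and separation by species. -/

section idempotents

variable {A G : Type u} [CommGroup A] [CommGroup G] [Finite G] {k : Type v} [Field k]

omit [Finite G] in
theorem species_cls (ι : A →* kˣ) (K : Subgroup G) (l : G) (X : FiberedSet A G) :
    species ι K l (cls k X) = speciesVal ι K l X := lift_cls _ _ _ _ _

theorem cls_twisted_congr (V : Subgroup G) {ψ ψ' : G →* A} (h : ∀ v ∈ V, ψ v = ψ' v) :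
    cls k (twisted V ψ) = cls k (twisted V ψ') := by
  refine cls_iso k (isom_of_generates (twistedBase_generates V ψ) (twistedBase_generates V ψ') ?_)
  intro g a
  rw [smul_twistedBase, smul_twistedBase]
  exact and_congr_right fun hg => by rw [h g hg]

/-- The average of the classes `[A × G/V]`, twisted by all `ψ : G → A`, with weights `ψ(g⁻¹)`. -/
def avg [Fintype (G →* A)] (ι : A →* kˣ) (V : Subgroup G) (g : G) : kB A G k :=
  (Nat.card G : k)⁻¹ • ∑ ψ : G →* A, (ι (ψ g⁻¹) : k) • cls k (twisted V ψ)

/-- The idempotent `e^G_{V,g}`, obtained by Möbius inversion. -/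
def idem [Fintype (G →* A)] [Fintype (Subgroup G)] (ι : A →* kˣ) (g : G) (V : Subgroup G) :
    kB A G k :=
  (V.index : k)⁻¹ • avg ι V g -
    ∑ W : {W : Subgroup G // W < V}, idem ι g W.1
termination_by Nat.card V
decreasing_by exact Set.ncard_lt_ncard W.2 (Set.toFinite _)

variable [Fintype (G →* A)] [Fintype (Subgroup G)] (ι : A →* kˣ)

theorem sum_idem (hk : (Nat.card G : k) ≠ 0) (g : G) (V : Subgroup G) :
    avg ι V g = (V.index : k) • (idem ι g V + ∑ W : {W : Subgroup G // W < V}, idem ι g W.1) := by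
  have hV : (V.index : k) ≠ 0 := by
    rw [← V.card_mul_index, Nat.cast_mul] at hk
    exact right_ne_zero_of_mul hk
  rw [idem, sub_add_cancel, smul_inv_smul₀ hV]

variable [HasEnoughRootsOfUnity A (Monoid.exponent G)] (hι : Function.Injective ι)
  (hk : (Nat.card G : k) ≠ 0)
include hι hk

omit [Fintype (Subgroup G)] in
-- Orthogonality of characters isolates `l = g`; what remains is the condition `K ≤ V`, to be
-- removed by Möbius inversion.
theorem species_avg (V : Subgroup G) (g : G) {K : Subgroup G} {l : G} (hl : l ∈ K) :
    species ι K l (avg ι V g) = if K ≤ V ∧ l = g then (V.index : k) else 0 := by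
  simp only [avg, map_smul, map_sum, species_cls, speciesVal_twisted ι V _ K hl, smul_eq_mul]
  by_cases hKV : K ≤ V
  · have h : ∀ ψ : G →* A, (ι (ψ g⁻¹) : k) * (V.index * (ι (ψ l) : k)) =
        V.index * (ι (ψ (g⁻¹ * l)) : k) := by
      intro ψ
      rw [map_mul, map_mul, Units.val_mul]
      ring
    simp only [hKV, if_true, true_and, h]
    rw [← Finset.mul_sum, sum_hom_apply ι hι, inv_mul_eq_one]
    simp only [eq_comm (a := g)]
    split_ifs
    · field_simp
    · simp
  · simp [hKV]

omit [Fintype (Subgroup G)] [HasEnoughRootsOfUnity A (Monoid.exponent G)] in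
-- Fourier inversion: the averages recover the twisted transitive sets, which is needed for
-- spanning.
theorem sum_smul_avg [Fintype G] (V : Subgroup G) (ψ : G →* A) :
    ∑ g, (ι (ψ g) : k) • avg ι V g = cls k (twisted V ψ) := by
  simp only [avg, smul_comm (_ : k) (Nat.card G : k)⁻¹, ← Finset.smul_sum]
  rw [inv_smul_eq_iff₀ hk]
  simp only [Finset.smul_sum]
  rw [Finset.sum_comm]
  have h : ∀ ψ' : G →* A, ∑ g : G, (ι (ψ g) : k) • (ι (ψ' g⁻¹) : k) • cls k (twisted V ψ') =
      if ψ' = ψ then (Nat.card G : k) • cls k (twisted V ψ') else 0 := by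
    intro ψ'
    have h1 : ∀ g, (ι (ψ g) : k) • (ι (ψ' g⁻¹) : k) • cls k (twisted V ψ') =
        (ι ((ψ / ψ') g) : k) • cls k (twisted V ψ') := by
      intro g
      rw [smul_smul, ← Units.val_mul, ← map_mul, map_inv, ← div_eq_mul_inv]
      rfl
    simp only [h1, ← Finset.sum_smul, sum_apply_eq ι hι, div_eq_one, eq_comm (a := ψ), ite_smul,
      zero_smul]
  simp only [h, Finset.sum_ite_eq', Finset.mem_univ, if_true]

omit hk [Fintype (Subgroup G)] in
-- Twisting by a character `χ` trivial on `V` leaves each class unchanged but rescales the sum by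
-- `χ(g⁻¹)`, which can be made different from `1`.
theorem avg_eq_zero {V : Subgroup G} {g : G} (hg : g ∉ V) : avg (k := k) ι V g = 0 := by
  obtain ⟨χ, hχV, hχ⟩ := exists_hom_apply_ne_one_of_notMem A V hg
  suffices h : (ι (χ g⁻¹) : k) • ∑ ψ : G →* A, (ι (ψ g⁻¹) : k) • cls k (twisted V ψ) =
      ∑ ψ : G →* A, (ι (ψ g⁻¹) : k) • cls k (twisted V ψ) by
    have h2 : ((ι (χ g⁻¹) : k) - 1) • ∑ ψ : G →* A, (ι (ψ g⁻¹) : k) • cls k (twisted V ψ) = 0 := by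
      rw [sub_smul, h, one_smul, sub_self]
    rcases smul_eq_zero.1 h2 with h3 | h3
    · refine absurd (hι ?_) hχ
      rw [map_one, ← inv_inj, ← map_inv, ← map_inv, inv_one]
      exact Units.ext (sub_eq_zero.1 h3)
    · rw [avg, h3, smul_zero]
  rw [Finset.smul_sum]
  refine Fintype.sum_equiv (Equiv.mulLeft χ) _ _ fun ψ => ?_
  rw [smul_smul, ← Units.val_mul, ← map_mul,
    cls_twisted_congr V (ψ := ψ) (ψ' := χ * ψ) fun v hv => by simp [hχV v hv]]
  rfl

theorem species_idem (g : G) (V : Subgroup G) {K : Subgroup G} {l : G} (hl : l ∈ K) :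
    species ι K l (idem ι g V) = if K = V ∧ l = g then (1 : k) else 0 := by
  induction hn : Nat.card V using Nat.strong_induction_on generalizing V with
  | _ n ih =>
  subst hn
  have hV : (V.index : k) ≠ 0 := by
    have h := hk
    rw [← V.card_mul_index, Nat.cast_mul] at h
    exact right_ne_zero_of_mul h
  have h1 : ∀ W : {W : Subgroup G // W < V}, species ι K l (idem ι g W.1) =
      if K = W.1 ∧ l = g then (1 : k) else 0 := fun W =>
    ih _ (Set.ncard_lt_ncard W.2 (Set.toFinite _)) W.1 rfl
  rw [idem, map_sub, map_smul, map_sum, species_avg ι hι hk V g hl,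
    Finset.sum_congr rfl fun W _ => h1 W]
  by_cases hlg : l = g
  · simp only [hlg, and_true]
    -- The correction terms cancel the value `1` exactly at proper subgroups `K < V`.
    have h2 : ∑ W : {W : Subgroup G // W < V}, (if K = W.1 then (1 : k) else 0) =
        if K < V then 1 else 0 := by
      split_ifs with h
      · rw [Finset.sum_eq_single ⟨K, h⟩]
        · simp
        · rintro W - hW
          exact if_neg fun h' => hW (Subtype.ext h'.symm)
        · simp
      · refine Finset.sum_eq_zero fun W _ => if_neg ?_
        rintro rfl
        exact h W.2
    rw [h2]
    rcases eq_or_ne K V with rfl | hKV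
    · simp [hV]
    · by_cases hle : K ≤ V
      · simp [hle, hle.lt_of_ne hKV, hKV, hV]
      · have : ¬ K < V := fun h => hle h.le
        simp [hle, this, hKV]
  · simp [hlg]

omit hk in
-- Species detect only pairs with `g ∈ V`; the remaining members of the spanning family must vanish
-- for the species to separate points.
theorem idem_eq_zero {g : G} (V : Subgroup G) (hg : g ∉ V) : idem (k := k) ι g V = 0 := by
  induction hn : Nat.card V using Nat.strong_induction_on generalizing V with
  | _ n ih =>
  subst hn
  rw [idem, avg_eq_zero ι hι hg, smul_zero, zero_sub, neg_eq_zero]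
  exact Finset.sum_eq_zero fun W _ =>
    ih _ (Set.ncard_lt_ncard W.2 (Set.toFinite _)) W.1 (fun h => hg (W.2.le h)) rfl

theorem span_idem : Submodule.span k
    (Set.range fun s : Subgroup G × G => idem (A := A) (k := k) ι s.2 s.1) = ⊤ := by
  have := Fintype.ofFinite G
  set S := Submodule.span k (Set.range fun s : Subgroup G × G => idem (A := A) (k := k) ι s.2 s.1)
  have hidem : ∀ V g, idem ι g V ∈ S := fun V g => Submodule.subset_span ⟨(V, g), rfl⟩
  have havg : ∀ V g, avg ι V g ∈ S := fun V g => by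
    rw [sum_idem ι hk]
    exact S.smul_mem _ (S.add_mem (hidem _ _) (S.sum_mem fun W _ => hidem _ _))
  have htw : ∀ V (ψ : G →* A), cls k (twisted V ψ) ∈ S := fun V ψ => by
    rw [← sum_smul_avg ι hι hk]
    exact S.sum_mem fun g _ => S.smul_mem _ (havg _ _)
  rw [eq_top_iff, ← span_cls k, Submodule.span_le]
  rintro _ ⟨X, rfl⟩
  refine cls_mem_of_generates S (fun X x hx => ?_) X
  -- Extending the character of the stabilizer to all of `G` identifies any transitive set with a
  -- `twisted` one.
  obtain ⟨ψ, hψ⟩ := exists_hom_extension (fiberStab x) (fiberHom x)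
  rw [cls_iso k (isom_of_generates hx (twistedBase_generates (fiberStab x) ψ) fun g a => ?_)]
  · exact htw _ _
  · rw [smul_twistedBase, smul_eq_smul_iff]
    exact and_congr_right fun hg => by rw [← hψ ⟨g, hg⟩ |>.symm]; rfl

theorem eq_zero_of_species {x : kB A G k}
    (hx : ∀ (K : Subgroup G) (l : G), l ∈ K → species ι K l x = 0) : x = 0 := by
  have := Fintype.ofFinite G
  have hmem : x ∈ Submodule.span k
      (Set.range fun s : Subgroup G × G => idem (A := A) (k := k) ι s.2 s.1) := by
    rw [span_idem ι hι hk]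
    trivial
  obtain ⟨c, rfl⟩ := (Submodule.mem_span_range_iff_exists_fun k).1 hmem
  refine Finset.sum_eq_zero fun s _ => ?_
  by_cases hs : s.2 ∈ s.1
  -- The species at the pair `s` reads off the coefficient `c s`.
  · have h := hx s.1 s.2 hs
    simp only [map_sum, map_smul, species_idem ι hι hk _ _ hs, smul_eq_mul] at h
    rw [Finset.sum_eq_single s] at h
    · simp only [and_self, if_true, mul_one] at h
      rw [h, zero_smul]
    · intro t _ ht
      rw [if_neg, mul_zero]
      rintro ⟨h1, h2⟩
      exact ht (Prod.ext h1.symm h2.symm)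
    · simp
  · rw [idem_eq_zero ι hι _ hs, smul_zero]

end idempotents

/-! ### Existence and uniqueness of the idempotents. -/

section existence

variable {A G : Type u} [CommGroup A] [CommGroup G] [Finite G] {k : Type v} [Field k]
  [HasEnoughRootsOfUnity A (Monoid.exponent G)] (ι : A →* kˣ)

/-- The species separate the points of `k B^A(G)`. -/
theorem eq_of_species (hι : Function.Injective ι) (hk : (Nat.card G : k) ≠ 0) {x y : kB A G k}
    (h : ∀ (K : Subgroup G) (l : G), l ∈ K → species ι K l x = species ι K l y) : x = y := by
  have := finite_hom A G
  have := Fintype.ofFinite (G →* A)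
  have := Fintype.ofFinite (Subgroup G)
  refine sub_eq_zero.1 (eq_zero_of_species ι hι hk fun K l hl => ?_)
  rw [map_sub, h K l hl, sub_self]

/-- Characters of `G` restricted to `K` already separate the elements of `K`. -/
theorem homKer_eq_bot (K : Subgroup G) : homKer A K = ⊥ := by
  rw [homKer, (Subgroup.map_eq_bot_iff_of_injective _ K.subtype_injective), eq_bot_iff]
  intro x hx
  by_contra h
  obtain ⟨ψ, -, hψ⟩ := exists_hom_apply_ne_one_of_notMem A (⊥ : Subgroup G) (x := x)
    (by simpa using h)
  exact hψ ((Subgroup.mem_iInf.1 hx) (ψ.comp K.subtype))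

theorem pairConj_iff (H : Subgroup G) (h : G) (K : Subgroup G) (l : G) :
    PairConj A H h K l ↔ K = H ∧ l = h := by
  have hmap : ∀ x : G, H.map (MulAut.conj x).toMonoidHom = H := fun x => by
    have : (MulAut.conj x).toMonoidHom = MonoidHom.id G := by ext; simp
    rw [this, Subgroup.map_id]
  simp only [PairConj, hmap, homKer_eq_bot, Subgroup.mem_bot, mul_inv_eq_one, mul_right_comm _ h,
    mul_inv_cancel, one_mul, exists_const, eq_comm]

theorem existsUnique_isIdempotentAt (hι : Function.Injective ι) (hk : (Nat.card G : k) ≠ 0)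
    (H : Subgroup G) (h : G) : ∃! e : kB A G k, IsIdempotentAt ι H h e := by
  have := finite_hom A G
  have := Fintype.ofFinite (G →* A)
  have := Fintype.ofFinite (Subgroup G)
  refine ⟨idem ι h H, fun K l hl => ?_, fun e he => eq_of_species ι hι hk fun K l hl => ?_⟩
  · simp only [species_idem ι hι hk h H hl, pairConj_iff]
  · rw [he K l hl, species_idem ι hι hk h H hl]
    simp only [pairConj_iff]

end existence

/-! ### Deflation of a transitive fibered set. -/

section deflationBiset

variable {A G : Type u} [CommGroup A] [CommGroup G] [Finite G] (N : Subgroup G)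

variable (A) in
/-- The `A`-fibered biset `A × G/N` defining the deflation. -/
abbrev deflBiset : FiberedSet A ((G ⧸ N) × G) :=
  ofGSet A (G := (G ⧸ N) × G) (DefSet N)

variable (A) in
/-- The base point of `A × G/N`. -/
def deflBase : (deflBiset A N).carrier := Fibered.mk 1 ⟨1⟩

/-- The image of a point under deflation, where `A` need not act freely. -/
def deflPoint {X : FiberedSet A G} (x : X.carrier) : Amalg (deflBiset A N) X :=
  Amalg.mk (deflBase A N) x

variable {N} {X : FiberedSet A G}

theorem smul_deflBase (a : A) (c : G ⧸ N) (g : G) :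
    a • ((c, g) : (G ⧸ N) × G) • deflBase A N = Fibered.mk a (DefSet.mk (c * (g : G ⧸ N)⁻¹)) := by
  change Fibered.mk (a * 1) (DefSet.mk (c * 1 * (g : G ⧸ N)⁻¹)) = _
  rw [mul_one, mul_one]

/-- `A × G` is transitive on `A × G/N`, so the first coordinate can be moved to the base point. -/
theorem deflPoint_surjective (q : Amalg (deflBiset A N) X) : ∃ x, q = deflPoint N x := by
  obtain ⟨⟨a, ⟨⟨g⟩⟩⟩, x, rfl⟩ := Amalg.exists_rep q
  refine ⟨a • g • x, Amalg.mk_eq.2 ⟨a, g, ?_, rfl⟩⟩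
  change Fibered.mk (1 : A) (DefSet.mk (1 : G ⧸ N)) =
    Fibered.mk (a⁻¹ * a) (DefSet.mk (1 * (g : G ⧸ N) * (g : G ⧸ N)⁻¹))
  simp

/-- The stabilizer of the base point of `A × G/N` in `A × G` is `1 × N`, so the amalgamated product
is the set of `N`-orbits on `X`. -/
theorem deflPoint_eq_iff {x y : X.carrier} :
    deflPoint N x = deflPoint N y ↔ ∃ n ∈ N, y = n • x := by
  rw [deflPoint, deflPoint, Amalg.mk_eq]
  simp only [smul_deflBase]
  constructor
  · rintro ⟨a, g, h1, h2⟩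
    have h3 : (1 : A) = a⁻¹ := congrArg Fibered.fib h1
    have h4 : (1 : G ⧸ N) = 1 * (g : G ⧸ N)⁻¹ := congrArg (fun z => DefSet.pt (Fibered.pt z)) h1
    rw [one_mul, eq_comm, inv_eq_one, QuotientGroup.eq_one_iff] at h4
    rw [eq_comm, inv_eq_one] at h3
    exact ⟨g, h4, by rw [h2, h3, one_smul]⟩
  · rintro ⟨n, hn, rfl⟩
    refine ⟨1, n, ?_, by rw [one_smul]⟩
    rw [(QuotientGroup.eq_one_iff n).2 hn]
    rw [inv_one, inv_one, mul_one]
    rfl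

theorem smul_deflPoint (a : A) (x : X.carrier) : a • deflPoint N x = deflPoint N (a • x) :=
  (Amalg.mk_smul _ _ _).symm

theorem coe_smul_deflPoint (g : G) (x : X.carrier) :
    (g : G ⧸ N) • deflPoint N x = deflPoint N (g • x) := by
  rw [deflPoint, Amalg.smulL_mk]
  refine Amalg.mk_eq.2 ⟨1, g, ?_, by rw [one_smul]⟩
  rw [smul_smul ((1 : G ⧸ N), g), inv_one]
  refine Eq.trans ?_ (smul_deflBase _ _ _).symm
  simp
  rfl

/-- `A` acts freely on the image of `x` under deflation. -/
def DeflFree (N : Subgroup G) (x : X.carrier) : Prop :=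
  ∀ n ∈ N, ∀ a : A, n • x = a • x → a = 1

omit [Finite G] in
theorem smul_eq_smul_iff_smul (a b : A) (g h : G) (x : X.carrier) :
    g • a • h • x = b • a • h • x ↔ g • x = b • x := by
  rw [smul_eq_iff, smul_smul, mul_comm, mul_smul, smul_comm b h, smul_left_cancel_iff]

theorem deflFree_iff (x : X.carrier) :
    (∀ a : A, a • deflPoint N x = deflPoint N x → a = 1) ↔ DeflFree N x := by
  simp only [smul_deflPoint, deflPoint_eq_iff]
  constructor
  · intro h n hn a hna
    refine inv_eq_one.1 (h a⁻¹ ⟨n, hn, ?_⟩)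
    rw [← smul_comm, hna, inv_smul_smul]
  · rintro h a ⟨n, hn, hna⟩
    refine inv_eq_one.1 (h n hn a⁻¹ ?_)
    rw [eq_inv_smul_iff, smul_comm, ← hna]

/-- All points of the orbit have the same stabilizer and character, so freeness holds at all of them
or at none. -/
theorem isEmpty_tensor_of_generates {x : X.carrier} (hx : Generates x) (h : ¬ DeflFree N x) :
    IsEmpty (tensor (deflBiset A N) X).carrier := by
  refine ⟨fun q => h ?_⟩
  obtain ⟨y, hy⟩ := deflPoint_surjective q.1
  have h2 := (deflFree_iff y).1 (hy ▸ q.2)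
  obtain ⟨a, g, rfl⟩ := hx y
  intro n hn b hb
  exact h2 n hn b ((smul_eq_smul_iff_smul a b n g x).2 hb)

/-- The point of the deflation of `X` given by `x`. -/
def deflPointFree {x : X.carrier} (h : DeflFree N x) : (tensor (deflBiset A N) X).carrier :=
  ⟨deflPoint N x, (deflFree_iff x).2 h⟩

theorem deflPointFree_generates {x : X.carrier} (hx : Generates x) (h : DeflFree N x) :
    Generates (deflPointFree h) := by
  intro q
  obtain ⟨y, hy⟩ := deflPoint_surjective q.1
  obtain ⟨a, g, rfl⟩ := hx y
  refine ⟨a, g, Subtype.ext ?_⟩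
  change q.1 = a • (g : G ⧸ N) • deflPoint N x
  rw [hy, coe_smul_deflPoint, smul_deflPoint]

theorem smul_deflPointFree {x : X.carrier} (h : DeflFree N x) (g : G) (a : A) :
    (g : G ⧸ N) • deflPointFree h = a • deflPointFree h ↔ ∃ n ∈ N, (g * n) • x = a • x := by
  have h1 : (g : G ⧸ N) • deflPointFree h = a • deflPointFree h ↔
      (g : G ⧸ N) • deflPoint N x = a • deflPoint N x := Subtype.ext_iff
  rw [h1, coe_smul_deflPoint, smul_deflPoint, deflPoint_eq_iff]
  simp only [smul_smul, mul_comm g, eq_comm]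

theorem comap_fiberStab_deflPointFree {x : X.carrier} (h : DeflFree N x) :
    (fiberStab (deflPointFree h)).comap (QuotientGroup.mk' N) = fiberStab x ⊔ N := by
  ext g
  rw [Subgroup.mem_comap, mem_fiberStab, Subgroup.mem_sup]
  simp only [QuotientGroup.mk'_apply, smul_deflPointFree]
  constructor
  · rintro ⟨a, n, hn, hna⟩
    exact ⟨g * n, ⟨a, hna⟩, n⁻¹, N.inv_mem hn, by simp⟩
  · rintro ⟨v, ⟨a, ha⟩, n, hn, rfl⟩
    exact ⟨a, n⁻¹, N.inv_mem hn, by simpa using ha⟩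

variable {k : Type v} [Field k]

/-- The species of the deflation of a transitive fibered set. -/
theorem speciesVal_tensor (ι : A →* kˣ) {x : X.carrier} (hx : Generates x)
    (h : DeflFree N x) (K : Subgroup (G ⧸ N)) (l : G) :
    speciesVal ι K (l : G ⧸ N) (tensor (deflBiset A N) X) =
      if K.comap (QuotientGroup.mk' N) ≤ fiberStab x ⊔ N then
        (fiberStab x ⊔ N).index * (ι (fiberChar (l : G ⧸ N) (deflPointFree h)) : k) else 0 := by
  rw [speciesVal_of_generates ι (deflPointFree_generates hx h),
    ← comap_fiberStab_deflPointFree h, Subgroup.index_comap_of_surjective _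
      (QuotientGroup.mk'_surjective N), Subgroup.comap_le_comap_of_surjective
      (QuotientGroup.mk'_surjective N)]

theorem species_deflation_cls (ι : A →* kˣ) (N : Subgroup G) (K : Subgroup (G ⧸ N)) (l : G ⧸ N)
    (X : FiberedSet A G) :
    species ι K l (deflation A k N (cls k X)) = speciesVal ι K l (tensor (deflBiset A N) X) := by
  rw [deflation, bisetMap, lift_cls]
  exact lift_cls _ _ _ _ _

end deflationBiset

/-! ### Subgroups of prime order and their complements. -/

section primeOrder

variable {A G : Type u} [CommGroup A] [CommGroup G] [Finite G]

/-- The complements of `⟨h⟩` in `K` containing `m`, if `h` has prime order. -/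
def complements (h : G) (K : Subgroup G) (m : G) : Finset (Subgroup G) :=
  letI := Fintype.ofFinite (Subgroup G)
  Finset.univ.filter fun L => h ∉ L ∧ L ⊔ Subgroup.zpowers h = K ∧ m ∈ L

theorem mem_complements {h : G} {K : Subgroup G} {m : G} {L : Subgroup G} :
    L ∈ complements h K m ↔ h ∉ L ∧ L ⊔ Subgroup.zpowers h = K ∧ m ∈ L := by
  simp [complements]

omit [Finite G] in
theorem zpowers_inf_eq_bot {p : ℕ} (hp : p.Prime) {h : G} (hh : orderOf h = p) {V : Subgroup G}
    (hV : h ∉ V) : Subgroup.zpowers h ⊓ V = ⊥ := by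
  have : Fact (Nat.card (Subgroup.zpowers h)).Prime := ⟨by rwa [Nat.card_zpowers, hh]⟩
  rcases (V.subgroupOf (Subgroup.zpowers h)).eq_bot_or_eq_top_of_prime_card with h1 | h1
  · rw [Subgroup.subgroupOf_eq_bot, disjoint_iff, inf_comm] at h1
    exact h1
  · rw [Subgroup.subgroupOf_eq_top] at h1
    exact absurd (h1 (Subgroup.mem_zpowers h)) hV

theorem mem_zpowers_iff_range {p : ℕ} {h : G} (hh : orderOf h = p) (n : G) :
    n ∈ Subgroup.zpowers h ↔ ∃ i ∈ Finset.range p, h ^ i = n := by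
  rw [← hh]
  exact (isOfFinOrder_of_finite h).mem_zpowers_iff_mem_range_orderOf.trans (by simp)

omit [Finite G] in
theorem index_eq_mul_index_sup {p : ℕ} (hp : p.Prime) {h : G} (hh : orderOf h = p)
    {V : Subgroup G} (hV : h ∉ V) : V.index = p * (V ⊔ Subgroup.zpowers h).index := by
  rw [← Subgroup.relIndex_mul_index (le_sup_left : V ≤ V ⊔ Subgroup.zpowers h),
    Subgroup.relIndex_sup_left, ← Subgroup.inf_relIndex_right, inf_comm,
    zpowers_inf_eq_bot hp hh hV, Subgroup.relIndex_bot_left, Nat.card_zpowers, hh]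

/-- The modular law, used twice: `L ≤ V` gives `(L ⊔ ⟨h⟩) ⊓ V = L ⊔ (⟨h⟩ ⊓ V) = L`, and `(K ⊓ V) ⊔
⟨h⟩ = K ⊓ (V ⊔ ⟨h⟩)`. -/
theorem complements_filter_le {p : ℕ} (hp : p.Prime) {h : G} (hh : orderOf h = p) {V : Subgroup G}
    (hV : h ∉ V) {K : Subgroup G} (hK : h ∈ K) {m : G} (hm : m ∈ K) :
    (complements h K m).filter (· ≤ V) =
      if K ≤ V ⊔ Subgroup.zpowers h ∧ m ∈ V then {K ⊓ V} else ∅ := by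
  have hHK : Subgroup.zpowers h ≤ K := by rwa [Subgroup.zpowers_le]
  split_ifs with hc
  · ext L
    rw [Finset.mem_filter, mem_complements, Finset.mem_singleton]
    constructor
    · rintro ⟨⟨h1, rfl, h3⟩, h4⟩
      rw [sup_inf_assoc_of_le _ h4, zpowers_inf_eq_bot hp hh hV, sup_bot_eq]
    · rintro rfl
      refine ⟨⟨fun h' => hV h'.2, ?_, hm, hc.2⟩, inf_le_right⟩
      rw [inf_sup_assoc_of_le _ hHK, inf_eq_left.2 hc.1]
  · rw [Finset.filter_eq_empty_iff]
    intro L hL hLV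
    obtain ⟨h1, rfl, h3⟩ := mem_complements.1 hL
    exact hc ⟨sup_le_sup_right hLV _, hLV h3⟩

end primeOrder

/-! ### Species of a deflation by a subgroup of prime order. -/

section formula

variable {A G : Type u} [CommGroup A] [CommGroup G] [Finite G] {k : Type v} [Field k]
  (ι : A →* kˣ) (hι : Function.Injective ι) {p : ℕ} (hp : p.Prime) {h : G} (hh : orderOf h = p)
include hι hp hh

omit hp in
theorem speciesVal_tensor_of_mem {X : FiberedSet A G} {x : X.carrier} (hx : Generates x)
    (hV : h ∈ fiberStab x) (K : Subgroup (G ⧸ Subgroup.zpowers h)) (l : G)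
    (hl : (l : G ⧸ Subgroup.zpowers h) ∈ K) :
    (p : k) * speciesVal ι K (l : G ⧸ Subgroup.zpowers h)
        (tensor (deflBiset A (Subgroup.zpowers h)) X) =
      ∑ i ∈ Finset.range p,
        speciesVal ι (K.comap (QuotientGroup.mk' (Subgroup.zpowers h))) (l * h ^ i) X := by
  set K' := K.comap (QuotientGroup.mk' (Subgroup.zpowers h)) with hK'
  have hlK : l ∈ K' := hl
  have hHV : Subgroup.zpowers h ≤ fiberStab x := by rwa [Subgroup.zpowers_le]
  simp only [speciesVal_of_generates ι hx]
  have hchar : ∀ i, l ∈ fiberStab x → fiberChar (A := A) (l * h ^ i) x =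
      fiberChar l x * fiberChar h x ^ i := fun i hlx => by
    have := map_mul (fiberHom x) ⟨l, hlx⟩ (⟨h, hV⟩ ^ i)
    rwa [map_pow] at this
  by_cases hf : DeflFree (Subgroup.zpowers h) x
  · rw [speciesVal_tensor ι hx hf, sup_eq_left.2 hHV]
    by_cases hK : K' ≤ fiberStab x
    · have h1 : fiberChar (A := A) h x = 1 :=
        hf h (Subgroup.mem_zpowers h) _ (smul_eq_fiberChar_smul hV)
      have h2 : fiberChar (A := A) (l : G ⧸ Subgroup.zpowers h) (deflPointFree hf) =
          fiberChar l x := by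
        refine fiberChar_eq ((smul_deflPointFree hf l _).2 ⟨1, Subgroup.one_mem _, ?_⟩)
        rw [mul_one, smul_eq_fiberChar_smul (hK hlK)]
      simp [hK, hchar _ (hK hlK), h1, h2, ← hK']
    · simp [hK, ← hK']
  -- Here the deflation is empty, and `φ_x(h)` is a nontrivial `p`-th root of unity, so the
  -- geometric sum on the right vanishes too.
  · have := isEmpty_tensor_of_generates hx hf
    rw [speciesVal, finsum_of_isEmpty, mul_zero]
    by_cases hK : K' ≤ fiberStab x
    · have h1 : (ι (fiberChar (A := A) h x) : k) ≠ 1 := by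
        intro h1
        refine hf fun n hn a hna => ?_
        obtain ⟨i, -, rfl⟩ := (mem_zpowers_iff_range hh n).1 hn
        have h2 : fiberChar (A := A) h x = 1 := hι (by rw [map_one]; exact Units.ext h1)
        rw [← fiberChar_eq hna]
        have := map_pow (fiberHom x) ⟨h, hV⟩ i
        exact this.trans (by change fiberChar h x ^ i = 1; rw [h2, one_pow])
      have h2 : (ι (fiberChar (A := A) h x) : k) ^ p = 1 := by
        rw [← Units.val_pow_eq_pow_val, ← map_pow]
        have h3 := map_pow (fiberHom x) ⟨h, hV⟩ p
        have h4 : (⟨h, hV⟩ : fiberStab x) ^ p = 1 := Subtype.ext (by simp [← hh, pow_orderOf_eq_one])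
        rw [h4, map_one] at h3
        have h5 : fiberChar (A := A) h x ^ p = 1 := h3.symm
        rw [h5, map_one, Units.val_one]
      have h6 := geom_sum_eq h1 p
      rw [h2, sub_self, zero_div] at h6
      simp only [hK, if_true, hchar _ (hK hlK), map_mul, map_pow, Units.val_mul,
        Units.val_pow_eq_pow_val, ← Finset.mul_sum, h6, mul_zero]
    · simp [hK]

omit hι in
theorem speciesVal_tensor_of_notMem {X : FiberedSet A G} {x : X.carrier} (hx : Generates x)
    (hV : h ∉ fiberStab x) (K : Subgroup (G ⧸ Subgroup.zpowers h)) (l : G)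
    (hl : (l : G ⧸ Subgroup.zpowers h) ∈ K) :
    (p : k) * speciesVal ι K (l : G ⧸ Subgroup.zpowers h)
        (tensor (deflBiset A (Subgroup.zpowers h)) X) =
      ∑ i ∈ Finset.range p,
        ∑ L ∈ complements h (K.comap (QuotientGroup.mk' (Subgroup.zpowers h))) (l * h ^ i),
          speciesVal ι L (l * h ^ i) X := by
  have hhK : h ∈ K.comap (QuotientGroup.mk' (Subgroup.zpowers h)) := by
    rw [Subgroup.mem_comap, QuotientGroup.mk'_apply,
      (QuotientGroup.eq_one_iff h).2 (Subgroup.mem_zpowers h)]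
    exact K.one_mem
  -- `⟨h⟩` meets the stabilizer trivially, so freeness is automatic.
  have hf : DeflFree (Subgroup.zpowers h) x := by
    intro n hn a hna
    have h1 : n ∈ Subgroup.zpowers h ⊓ fiberStab x := ⟨hn, a, hna⟩
    rw [zpowers_inf_eq_bot hp hh hV, Subgroup.mem_bot] at h1
    rw [← fiberChar_eq hna, h1]
    exact fiberChar_eq (by simp)
  rw [speciesVal_tensor ι hx hf]
  set K' := K.comap (QuotientGroup.mk' (Subgroup.zpowers h)) with hK'
  have hlK : l ∈ K' := hl
  have hmK : ∀ i, l * h ^ i ∈ K' := fun i => K'.mul_mem hlK (K'.pow_mem hhK i)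
  simp only [speciesVal_of_generates ι hx, ← Finset.sum_filter,
    complements_filter_le hp hh hV hhK (hmK _)]
  by_cases hK : K' ≤ fiberStab x ⊔ Subgroup.zpowers h
  · simp only [hK, if_true, true_and]
    -- Exactly one element `l * h ^ i` of the coset lies in the stabilizer `V`; there the deflated
    -- character takes its value, and `p * [G : V⟨h⟩] = [G : V]` matches the coefficients.
    obtain ⟨v, hv, n, hn, hvn⟩ := Subgroup.mem_sup.1 (hK hlK)
    obtain ⟨i, hi, hin⟩ := (mem_zpowers_iff_range hh n⁻¹).1 (Subgroup.inv_mem _ hn)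
    have hvi : v = l * h ^ i := by rw [hin, ← hvn, mul_inv_cancel_right]
    rw [Finset.sum_eq_single_of_mem i hi]
    · rw [if_pos (hvi ▸ hv), Finset.sum_singleton, ← mul_assoc, ← Nat.cast_mul,
        ← index_eq_mul_index_sup hp hh hV]
      congr 3
      refine fiberChar_eq ((smul_deflPointFree hf l _).2 ⟨h ^ i, ?_, ?_⟩)
      · exact Subgroup.pow_mem _ (Subgroup.mem_zpowers h) i
      · exact smul_eq_fiberChar_smul (hvi ▸ hv)
    · intro j hj hji
      rw [if_neg, Finset.sum_empty]
      intro hj'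
      have h1 : h ^ j * (h ^ i)⁻¹ ∈ Subgroup.zpowers h ⊓ fiberStab x := by
        refine ⟨Subgroup.mul_mem _ (Subgroup.pow_mem _ (Subgroup.mem_zpowers h) j)
          (Subgroup.inv_mem _ (Subgroup.pow_mem _ (Subgroup.mem_zpowers h) i)), ?_⟩
        have h2 := (fiberStab x).mul_mem hj' ((fiberStab x).inv_mem hv)
        rwa [hvi, mul_inv, mul_mul_mul_comm, mul_inv_cancel, one_mul] at h2
      rw [zpowers_inf_eq_bot hp hh hV, Subgroup.mem_bot, mul_inv_eq_one] at h1
      exact hji (pow_injOn_Iio_orderOf (by simpa [hh] using hj) (by simpa [hh] using hi) h1)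
  · simp [hK]

/-- The species of a deflation by a subgroup of prime order. -/
theorem species_deflation (K : Subgroup (G ⧸ Subgroup.zpowers h)) (l : G)
    (hl : (l : G ⧸ Subgroup.zpowers h) ∈ K) (x : kB A G k) :
    (p : k) * species ι K (l : G ⧸ Subgroup.zpowers h) (deflation A k (Subgroup.zpowers h) x) =
      ∑ i ∈ Finset.range p,
        (species ι (K.comap (QuotientGroup.mk' (Subgroup.zpowers h))) (l * h ^ i) x +
        ∑ L ∈ complements h (K.comap (QuotientGroup.mk' (Subgroup.zpowers h))) (l * h ^ i),
          (species ι L (l * h ^ i) x -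
            species ι (K.comap (QuotientGroup.mk' (Subgroup.zpowers h))) (l * h ^ i) x)) := by
  set K' := K.comap (QuotientGroup.mk' (Subgroup.zpowers h)) with hK'
  have hhK : h ∈ K' := by
    rw [hK', Subgroup.mem_comap, QuotientGroup.mk'_apply,
      (QuotientGroup.eq_one_iff h).2 (Subgroup.mem_zpowers h)]
    exact K.one_mem
  suffices hmaps : (p : k) • (species ι K (l : G ⧸ Subgroup.zpowers h) ∘ₗ
        deflation A k (Subgroup.zpowers h)) =
      ∑ i ∈ Finset.range p, (species ι K' (l * h ^ i) +
        ∑ L ∈ complements h K' (l * h ^ i), (species ι L (l * h ^ i) - species ι K' (l * h ^ i))) by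
    have := LinearMap.congr_fun hmaps x
    simpa only [LinearMap.smul_apply, LinearMap.comp_apply, smul_eq_mul, LinearMap.sum_apply,
      LinearMap.add_apply, LinearMap.sub_apply] using this
  refine kB_hom_ext fun X x hx => ?_
  simp only [LinearMap.smul_apply, LinearMap.comp_apply, smul_eq_mul, LinearMap.sum_apply,
      LinearMap.add_apply, LinearMap.sub_apply, species_cls, species_deflation_cls]
  by_cases hV : h ∈ fiberStab x
  · rw [speciesVal_tensor_of_mem ι hι hh hx hV K l hl]
    refine Finset.sum_congr rfl fun i _ => ?_
    rw [left_eq_add]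
    refine Finset.sum_eq_zero fun L hL => ?_
    obtain ⟨-, h2, -⟩ := mem_complements.1 hL
    -- As `h` stabilizes the fiber and `L` together with `h` generates `K'`, the species at `L` and
    -- at `K'` agree.
    have h3 : L ≤ fiberStab x ↔ K' ≤ fiberStab x := by
      rw [← h2, sup_le_iff, Subgroup.zpowers_le, and_iff_left hV]
    simp only [speciesVal_of_generates ι hx, h3, sub_self]
  · rw [speciesVal_tensor_of_notMem ι hp hh hx hV K l hl]
    have h3 : ¬ K' ≤ fiberStab x := fun h => hV (h hhK)
    have h4 : ∀ m, speciesVal ι K' m X = 0 := fun m => by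
      rw [speciesVal_of_generates ι hx, if_neg h3]
    simp only [← hK', h4, sub_zero, zero_add]

end formula

/-! ### Counting complements. -/

section counting

variable {A G : Type u} [CommGroup A] [CommGroup G] [Finite G] {p : ℕ}

/-- A cyclic group has at most `p` solutions of `b ^ p = 1`, and the powers of `z` already supply
`p` of them. -/
theorem mem_zpowers_of_pow_eq_one [IsCyclic A] [Finite A] (hp : p.Prime) {z a : A} (hz : z ≠ 1)
    (hzp : z ^ p = 1) (ha : a ^ p = 1) : a ∈ Subgroup.zpowers z := by
  have := Fintype.ofFinite A
  have : Fact p.Prime := ⟨hp⟩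
  have hz' : orderOf z = p := orderOf_eq_prime hzp hz
  have h1 : (Finset.univ.filter fun b : A => b ∈ Subgroup.zpowers z) ⊆
      Finset.univ.filter fun b : A => b ^ p = 1 := by
    intro b hb
    rw [Finset.mem_filter] at hb ⊢
    obtain ⟨i, rfl⟩ := Subgroup.mem_zpowers_iff.1 hb.2
    refine ⟨Finset.mem_univ _, ?_⟩
    rw [← zpow_natCast, zpow_comm, zpow_natCast, hzp, one_zpow]
  have h2 : (Finset.univ.filter fun b : A => b ∈ Subgroup.zpowers z).card = p := by
    rw [← Fintype.card_subtype, ← Nat.card_eq_fintype_card, ← hz']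
    exact Nat.card_zpowers z
  have h3 := Finset.eq_of_subset_of_card_le h1
    ((IsCyclic.card_pow_eq_one_le hp.pos).trans h2.ge)
  have h4 : a ∈ Finset.univ.filter fun b : A => b ^ p = 1 := by simp [ha]
  rw [← h3, Finset.mem_filter] at h4
  exact h4.2

/-- In an elementary abelian group, the complements of `⟨h⟩` containing `g` are the kernels of the
homomorphisms to `A` with prescribed values at `g` and `h`. -/
theorem card_complements [IsCyclic A] [Finite A] [HasEnoughRootsOfUnity A (Monoid.exponent G)]
    (hp : p.Prime) (hG : ∀ x : G, x ^ p = 1) {g h : G} (hgh : h ∉ Subgroup.zpowers g) :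
    (complements h ⊤ g).card = (Subgroup.zpowers g ⊔ Subgroup.zpowers h).index := by
  have hh : orderOf h = p := by
    have : Fact p.Prime := ⟨hp⟩
    exact orderOf_eq_prime (hG h) fun h1 => hgh (h1 ▸ Subgroup.one_mem _)
  obtain ⟨χ, hχg, hχh⟩ := exists_hom_apply_ne_one_of_notMem A (Subgroup.zpowers g) hgh
  have hχg' : χ g = 1 := hχg g (Subgroup.mem_zpowers g)
  have hpow : ∀ (φ : G →* A) (x : G), φ x ^ p = 1 := fun φ x => by rw [← map_pow, hG, map_one]
  set S := Subgroup.zpowers g ⊔ Subgroup.zpowers h with hS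
  have hgS : g ∈ S := Subgroup.mem_sup_left (Subgroup.mem_zpowers g)
  have hhS : h ∈ S := Subgroup.mem_sup_right (Subgroup.mem_zpowers h)
  -- The characters trivial on `S = ⟨g, h⟩`, that is, those of `G/S`, parametrize the complements by
  -- `ψ ↦ ker (ψ * χ)`.
  have hker : ∀ ψ : G →* A, ψ ∈ (MonoidHom.domRestrictHom S A).ker ↔ ψ g = 1 ∧ ψ h = 1 := by
    intro ψ
    rw [MonoidHom.mem_ker]
    constructor
    · intro hψ
      exact ⟨DFunLike.congr_fun hψ ⟨g, hgS⟩, DFunLike.congr_fun hψ ⟨h, hhS⟩⟩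
    · rintro ⟨h1, h2⟩
      have h3 : S ≤ ψ.ker := by
        rw [hS, sup_le_iff, Subgroup.zpowers_le, Subgroup.zpowers_le]
        exact ⟨h1, h2⟩
      ext s
      exact h3 s.2
  have hF : ∀ φ : G →* A, φ g = 1 → φ h ≠ 1 → φ.ker ∈ complements h ⊤ g := by
    intro φ h1 h2
    refine mem_complements.2 ⟨h2, ?_, h1⟩
    rw [eq_top_iff]
    intro x _
    obtain ⟨i, hi⟩ := Subgroup.mem_zpowers_iff.1
      (mem_zpowers_of_pow_eq_one hp h2 (hpow φ h) (hpow φ x))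
    refine Subgroup.mem_sup.2 ⟨x * (h ^ i)⁻¹, ?_, h ^ i, ⟨i, rfl⟩, by simp⟩
    rw [MonoidHom.mem_ker, map_mul, map_inv, map_zpow, hi, mul_inv_cancel]
  have hval : ∀ ψ : (MonoidHom.domRestrictHom S A).ker,
      (ψ.1 * χ) g = 1 ∧ (ψ.1 * χ) h = χ h := fun ψ => by
    obtain ⟨h1, h2⟩ := (hker ψ.1).1 ψ.2
    simp [h1, h2, hχg']
  let F : (MonoidHom.domRestrictHom S A).ker → complements h ⊤ g := fun ψ =>
    ⟨(ψ.1 * χ).ker, hF _ (hval ψ).1 (by rw [(hval ψ).2]; exact hχh)⟩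
  have hFbij : Function.Bijective F := by
    constructor
    · intro ψ ψ' hψ
      have h1 : (ψ.1 * χ).ker = (ψ'.1 * χ).ker := congrArg Subtype.val hψ
      refine Subtype.ext (mul_right_cancel (b := χ) ?_)
      ext x
      -- `G` is generated by the common kernel and `h`, and both characters take the value `χ h` at
      -- `h`.
      obtain ⟨-, h2, -⟩ := mem_complements.1 (F ψ).2
      have hx : x ∈ (ψ.1 * χ).ker ⊔ Subgroup.zpowers h := by
        rw [show (ψ.1 * χ).ker ⊔ Subgroup.zpowers h = ⊤ from h2]
        trivial
      obtain ⟨y, hy, n, hn, rfl⟩ := Subgroup.mem_sup.1 hx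
      obtain ⟨i, rfl⟩ := Subgroup.mem_zpowers_iff.1 hn
      have hy' : y ∈ (ψ'.1 * χ).ker := h1 ▸ hy
      rw [map_mul, map_mul (ψ'.1 * χ), map_zpow, map_zpow (ψ'.1 * χ), (hval ψ).2, (hval ψ').2,
        MonoidHom.mem_ker.1 hy, MonoidHom.mem_ker.1 hy']
    · rintro ⟨L, hL⟩
      obtain ⟨h1, h2, h3⟩ := mem_complements.1 hL
      obtain ⟨φ, hφL, hφh⟩ := exists_hom_apply_ne_one_of_notMem A L h1
      -- A character trivial on `L` but not at `h` is normalized by a power so that its value at `h`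
      -- becomes `χ h`.
      obtain ⟨i, hi⟩ := Subgroup.mem_zpowers_iff.1
        (mem_zpowers_of_pow_eq_one hp hφh (hpow φ h) (hpow χ h))
      have hψ : φ ^ i * χ⁻¹ ∈ (MonoidHom.domRestrictHom S A).ker := by
        rw [hker]
        have h4 : (φ ^ i) h = χ h := hi
        have h5 : (φ ^ i) g = 1 := by
          change φ g ^ i = 1
          rw [hφL g h3, one_zpow]
        simp [h4, h5, hχg']
      refine ⟨⟨_, hψ⟩, Subtype.ext ?_⟩
      change (φ ^ i * χ⁻¹ * χ).ker = L
      rw [inv_mul_cancel_right]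
      have h6 : L ≤ (φ ^ i).ker := fun x hx => by
        change φ x ^ i = 1
        rw [hφL x hx, one_zpow]
      have h7 : h ∉ (φ ^ i).ker := fun h' => hχh (hi.symm.trans h')
      -- `L` lies in a kernel that avoids `h`, so the modular law forces equality.
      rw [← top_inf_eq (φ ^ i).ker, ← h2, sup_inf_assoc_of_le _ h6,
        zpowers_inf_eq_bot hp hh h7, sup_bot_eq]
  have hQ : HasEnoughRootsOfUnity A (Monoid.exponent (G ⧸ S)) :=
    HasEnoughRootsOfUnity.of_dvd A (Group.exponent_quotient_dvd S)
  rw [← Nat.card_eq_finsetCard, ← Nat.card_congr (Equiv.ofBijective F hFbij),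
    Nat.card_congr (MonoidHom.domRestrictHomKerEquiv A S).toEquiv, card_hom A (G ⧸ S)]
  rfl

theorem complements_eq_empty (hp : p.Prime) {g h : G} (hh : orderOf h = p) (hg : g ≠ 1)
    (hgh : g ∈ Subgroup.zpowers h) (K : Subgroup G) : complements h K g = ∅ := by
  refine Finset.eq_empty_of_forall_notMem fun L hL => hg ?_
  obtain ⟨h1, -, h3⟩ := mem_complements.1 hL
  rw [← Subgroup.mem_bot, ← zpowers_inf_eq_bot hp hh h1]
  exact ⟨hgh, h3⟩

end counting

/-! ### The deflation of the idempotent. -/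

section main

variable {A G : Type u} [CommGroup A] [CommGroup G] [Finite G] {k : Type v} [Field k] {p : ℕ}

omit [Finite G] in
theorem hasEnoughRootsOfUnity_of_card [IsCyclic A] {n : ℕ} (hp : p.Prime) (hn : 0 < n)
    (hA : Nat.card A = p ^ n) (hG : ∀ x : G, x ^ p = 1) :
    HasEnoughRootsOfUnity A (Monoid.exponent G) := by
  have : Fact p.Prime := ⟨hp⟩
  have : Finite A := Nat.finite_of_card_ne_zero (by rw [hA]; exact pow_ne_zero _ hp.ne_zero)
  -- By Cauchy, `A` has an element of order `p`; this suffices because the exponent of `G` divides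
  -- `p`.
  obtain ⟨z, hz⟩ := exists_prime_orderOf_dvd_card' p (hA ▸ dvd_pow_self p hn.ne')
  have : IsCyclic Aˣ := isCyclic_of_surjective (toUnits : A ≃* Aˣ) (toUnits : A ≃* Aˣ).surjective
  have : HasEnoughRootsOfUnity A p := ⟨⟨z, hz ▸ IsPrimitiveRoot.orderOf z⟩, inferInstance⟩
  exact HasEnoughRootsOfUnity.of_dvd A (Monoid.exponent_dvd_of_forall_pow_eq_one hG)

/-- The deflation of the idempotent at `(G, g)` in terms of the number of complements of `⟨h⟩`
containing `g`. -/
theorem deflation_isIdempotentAt [HasEnoughRootsOfUnity A (Monoid.exponent G)] (ι : A →* kˣ)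
    (hι : Function.Injective ι) (hk : (Nat.card G : k) ≠ 0) (hp : p.Prime) {g h : G}
    (hh : orderOf h = p) {e : kB A G k} {e' : kB A (G ⧸ Subgroup.zpowers h) k}
    (he : IsIdempotentAt ι ⊤ g e)
    (he' : IsIdempotentAt ι ⊤ (g : G ⧸ Subgroup.zpowers h) e') :
    deflation A k (Subgroup.zpowers h) e =
      ((1 - ((complements h ⊤ g).card : k)) / (p : k)) • e' := by
  have hQ : HasEnoughRootsOfUnity A (Monoid.exponent (G ⧸ Subgroup.zpowers h)) :=
    HasEnoughRootsOfUnity.of_dvd A (Group.exponent_quotient_dvd _)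
  have hk' := hk
  rw [Subgroup.card_eq_card_quotient_mul_card_subgroup (Subgroup.zpowers h), Nat.cast_mul,
    Nat.card_zpowers, hh] at hk'
  have hpk : (p : k) ≠ 0 := right_ne_zero_of_mul hk'
  refine eq_of_species ι hι (left_ne_zero_of_mul hk') fun K q hq => ?_
  obtain ⟨l, rfl⟩ := QuotientGroup.mk_surjective q
  refine mul_left_cancel₀ hpk ?_
  rw [species_deflation ι hι hp hh K l hq, map_smul, smul_eq_mul, ← mul_assoc,
    mul_div_cancel₀ _ hpk, he' K _ hq]
  have hhK : h ∈ K.comap (QuotientGroup.mk' (Subgroup.zpowers h)) := by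
    rw [Subgroup.mem_comap, QuotientGroup.mk'_apply,
      (QuotientGroup.eq_one_iff h).2 (Subgroup.mem_zpowers h)]
    exact K.one_mem
  have htop : K.comap (QuotientGroup.mk' (Subgroup.zpowers h)) = ⊤ ↔ K = ⊤ := by
    rw [← Subgroup.comap_top (QuotientGroup.mk' (Subgroup.zpowers h))]
    exact (Subgroup.comap_injective (QuotientGroup.mk'_surjective _)).eq_iff
  have hlK : l ∈ K.comap (QuotientGroup.mk' (Subgroup.zpowers h)) := hq
  set K' := K.comap (QuotientGroup.mk' (Subgroup.zpowers h)) with hK'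
  have hterm : ∀ i ∈ Finset.range p, (species ι K' (l * h ^ i) e +
      ∑ L ∈ complements h K' (l * h ^ i),
        (species ι L (l * h ^ i) e - species ι K' (l * h ^ i) e)) =
      if K = ⊤ ∧ h ^ i = l⁻¹ * g then 1 - ((complements h ⊤ g).card : k) else 0 := by
    intro i _
    -- A complement omits `h`, hence is proper, and `e` is supported at the full group.
    have h1 : ∀ L ∈ complements h K' (l * h ^ i), species ι L (l * h ^ i) e = 0 := by
      intro L hL
      obtain ⟨h1, -, h3⟩ := mem_complements.1 hL
      rw [he L _ h3, if_neg]
      rw [pairConj_iff]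
      rintro ⟨rfl, -⟩
      exact h1 trivial
    rw [Finset.sum_sub_distrib, Finset.sum_eq_zero h1, he K' _ (K'.mul_mem hlK (K'.pow_mem hhK i)),
      Finset.sum_const, nsmul_eq_mul, zero_sub, ← sub_eq_add_neg]
    simp only [pairConj_iff, htop, ← eq_inv_mul_iff_mul_eq (b := l)]
    split_ifs with hc
    · rw [mul_one, htop.2 hc.1, hc.2, mul_inv_cancel_left]
    · rw [mul_zero, sub_zero]
  rw [Finset.sum_congr rfl hterm, pairConj_iff]
  -- If `l` and `g` agree modulo `⟨h⟩`, exactly one exponent `i < p` satisfies `l * h ^ i = g`.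
  by_cases hK : K = ⊤ ∧ (l : G ⧸ Subgroup.zpowers h) = g
  · obtain ⟨i, hi, hig⟩ := (mem_zpowers_iff_range hh _).1 (QuotientGroup.eq.1 hK.2)
    rw [if_pos hK, mul_one, Finset.sum_eq_single_of_mem i hi, if_pos ⟨hK.1, hig⟩]
    intro j hj hji
    refine if_neg fun hj' => hji ?_
    exact pow_injOn_Iio_orderOf (by simpa [hh] using hj) (by simpa [hh] using hi)
      (hj'.2.trans hig.symm)
  · rw [if_neg hK, mul_zero]
    refine Finset.sum_eq_zero fun i hi => if_neg fun hi' => hK ⟨hi'.1, QuotientGroup.eq.2 ?_⟩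
    exact (mem_zpowers_iff_range hh _).2 ⟨i, hi, hi'.2⟩

end main

end

end FiberedBurnside

theorem mainTheorem5 {A G : Type u} {k : Type v} [CommGroup A] [IsCyclic A] [CommGroup G]
    [Finite G] [Field k] [IsAlgClosed k] (p q n r : ℕ) (hp : p.Prime) (hn : 0 < n)
    (hA : Nat.card A = p ^ n) [CharP k q] (hq : q ≠ p)
    (ι : A →* kˣ) (hι : Function.Injective ι)
    (hG : ∀ x : G, x ^ p = 1) (hr : Nat.card G = p ^ r) (g h : G) (hh : h ≠ 1) :
    (∃! e : kB A G k, IsIdempotentAt ι ⊤ g e) ∧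
    (∃! e' : kB A (G ⧸ Subgroup.zpowers h) k,
      IsIdempotentAt ι ⊤ (g : G ⧸ Subgroup.zpowers h) e') ∧
    ∀ (e : kB A G k) (e' : kB A (G ⧸ Subgroup.zpowers h) k),
      IsIdempotentAt ι ⊤ g e → IsIdempotentAt ι ⊤ (g : G ⧸ Subgroup.zpowers h) e' →
      (g = 1 → deflation A k (Subgroup.zpowers h) e =
        ((1 - (p : k) ^ ((r : ℤ) - 1)) / (p : k)) • e') ∧
      (g ≠ 1 → g ∈ Subgroup.zpowers h → deflation A k (Subgroup.zpowers h) e =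
        (1 / (p : k)) • e') ∧
      (g ∉ Subgroup.zpowers h → deflation A k (Subgroup.zpowers h) e =
        ((1 - (p : k) ^ ((r : ℤ) - 2)) / (p : k)) • e') := by
  have : Fact p.Prime := ⟨hp⟩
  have : Finite A := Nat.finite_of_card_ne_zero (by rw [hA]; exact pow_ne_zero _ hp.ne_zero)
  have hE : HasEnoughRootsOfUnity A (Monoid.exponent G) := hasEnoughRootsOfUnity_of_card hp hn hA hG
  have hQ : HasEnoughRootsOfUnity A (Monoid.exponent (G ⧸ Subgroup.zpowers h)) :=
    HasEnoughRootsOfUnity.of_dvd A (Group.exponent_quotient_dvd _)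
  have hpk : (p : k) ≠ 0 := fun h0 => by
    rcases (Nat.dvd_prime hp).1 ((CharP.cast_eq_zero_iff k q p).1 h0) with h1 | h1
    · exact CharP.char_ne_one k q h1
    · exact hq h1
  have hk : (Nat.card G : k) ≠ 0 := by
    rw [hr, Nat.cast_pow]
    exact pow_ne_zero _ hpk
  have hk' : (Nat.card (G ⧸ Subgroup.zpowers h) : k) ≠ 0 := by
    rw [Subgroup.card_eq_card_quotient_mul_card_subgroup (Subgroup.zpowers h), Nat.cast_mul] at hk
    exact left_ne_zero_of_mul hk
  have hho : orderOf h = p := orderOf_eq_prime (hG h) hh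
  refine ⟨existsUnique_isIdempotentAt ι hι hk _ _, existsUnique_isIdempotentAt ι hι hk' _ _,
    fun e e' he he' => ?_⟩
  rw [deflation_isIdempotentAt ι hι hk hp hho he he']
  -- The number of complements is `[G : ⟨g, h⟩]`, and `p` times it is `[G : ⟨g⟩]`; Lagrange for
  -- `⟨g⟩` gives `p ^ r`.
  have hindex : h ∉ Subgroup.zpowers g →
      (orderOf g : k) * (p * ((complements h ⊤ g).card : k)) = (p : k) ^ r := fun hgh => by
    rw [card_complements (A := A) hp hG hgh, ← Nat.cast_mul, ← index_eq_mul_index_sup hp hho hgh,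
      ← Nat.cast_mul, ← Nat.card_zpowers, Subgroup.card_mul_index, hr, Nat.cast_pow]
  refine ⟨fun hg => ?_, fun hg hgh => ?_, fun hgh => ?_⟩
  · have h1 := hindex (by rw [hg, Subgroup.zpowers_one_eq_bot, Subgroup.mem_bot]; exact hh)
    rw [hg, orderOf_one, Nat.cast_one, one_mul] at h1
    -- The exponents are integers and `p` is invertible in `k`, so no lower bound on `r` has to be
    -- extracted.
    rw [zpow_sub_one₀ hpk, zpow_natCast, ← h1, hg, mul_comm (p : k), mul_inv_cancel_right₀ hpk]
  · rw [complements_eq_empty hp hho hg hgh, Finset.card_empty, Nat.cast_zero, sub_zero]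
  · have hgo : orderOf g = p :=
      orderOf_eq_prime (hG g) fun hg => hgh (hg ▸ Subgroup.one_mem _)
    -- Both elements have order `p`, so `g ∉ ⟨h⟩` makes `⟨g⟩` and `⟨h⟩` meet trivially, whence `h ∉
    -- ⟨g⟩`.
    have h1 := hindex fun hhg => hh (by
      rw [← Subgroup.mem_bot, ← zpowers_inf_eq_bot hp hgo hgh]
      exact ⟨hhg, Subgroup.mem_zpowers h⟩)
    rw [hgo, ← mul_assoc, ← sq] at h1
    rw [zpow_sub₀ hpk, zpow_natCast, ← h1, zpow_ofNat, mul_div_cancel_left₀ _ (pow_ne_zero 2 hpk)]
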